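/- **Conventions.** A category with a zero object is *pointed*. It is *homological* if it is pointed, regular (finite limits, coequalizers of kernel pairs, pullback-stable regular epimorphisms) and protomodular (the Split Short Five Lemma holds). *Projective* means projective with respect to regular epimorphisms; there are *enough projectives* if every object is the codomain of a regular epimorphism with projective domain. A *protosplit monomorphism* is a kernel of a split epimorphism; *Condition (P)* says that if $K\to X$ is a protosplit monomorphism and $X$ is projective, then $K$ is projective. A pair $A\xrightarrow{a}B\xrightarrow{b}D$ is *exact at $B$* if $ba=0$ and the induced morphism $A\to\operatorname{Ker}(b)$ is a regular epimorphism. A sequence $0\to K\xrightarrow{k}X\xrightarrow{f}Y\to0$ is *short exact* if $k$ is a kernel of $f$ and $f$ is a cokernel of $k$. A functor $F$ between pointed categories (with kernels in the codomain) is *sequentially right exact* if for each such short exact sequence, $F(K)\to F(X)\to F(Y)\to 0$ is exact (at $F(X)$ and at $F(Y)$, the latter meaning that $F(f)$ is a regular epimorphism); it *preserves protosplit monomorphisms* if it sends them to monomorphisms. A morphism is *proper* if it is a regular epimorphism followed by a kernel, and a chain complex is proper if its differentials are. For a proper chain complex $(C,d)$, $H_n(C)$ is the cokernel of the induced morphism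 $C_{n+1}\to \operatorname{Ker}(d_n)$. A *projective resolution* of $X$ is a chain complex $\cdots\to C_1\to C_0$ of projective objects with a regular epimorphism $d_0\colon C_0\to X$ such that the pairs $(d_{n+1},d_n)$, $n\ge0$, are exact at $C_n$. A *lifting* of $x\colon X\to Y$ to projective resolutions of $X$ and $Y$ is a chain morphism between them compatible with $x$ and the two morphisms $d_0$. **Theorem (Long exact homology sequence).** Let $\mathcal C$ be a homological category with binary coproducts and with enough projectives which satisfies Condition (P). Let $\mathcal E$ be a homological category with binary coproducts. Let $F\colon\mathcal C\to\mathcal E$ be a sequentially right exact functor that preserves protosplit monomorphisms and binary coproducts. Then every object of $\mathcal C$ has a projective resolution; $F$ sends projective resolutions to proper chain complexes, whose homology objects exist in $\mathcal E$; and any two liftings $\varphi$, $\psi$ of the same morphism to given projective resolutions satisfy $H_n(F(\varphi))=H_n(F(\psi))$ for all $n\ge 0$. Hence, for any choice of a projective resolution $C(X)$ of each object $X$, the left derived functors $\mathrm L_n(F)\colon\mathcal C\to\mathcal E$, $n\geq 0$, given by $\mathrm L_n(F)(X)=H_n(F(C(X)))$ and $\mathrm L_n(F)(x)=H_n(F(\varphi))$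 for any lifting $\varphi$ of $x$, are well defined. Moreover $\mathrm L_0(F)\cong F$, and for every short exact sequence $$0\to K\xrightarrow{k}X\xrightarrow{f}Y\to 0$$ in $\mathcal C$ there are morphisms $\delta_{n}\colon \mathrm L_{n}(F)(Y)\to \mathrm L_{n-1}(F)(K)$ for $n\ge 2$ and $\delta_1\colon \mathrm L_1(F)(Y)\to F(K)$ such that the sequence $$\cdots\to \mathrm L_n(F)(K)\xrightarrow{\mathrm L_n(F)(k)}\mathrm L_n(F)(X)\xrightarrow{\mathrm L_n(F)(f)}\mathrm L_n(F)(Y)\xrightarrow{\delta_n}\mathrm L_{n-1}(F)(K)\to\cdots\to \mathrm L_1(F)(Y)\xrightarrow{\delta_1}F(K)\xrightarrow{F(k)}F(X)\xrightarrow{F(f)}F(Y)\to 0$$ is exact in $\mathcal E$. The $\delta_n$ can be chosen for all short exact sequences at once so that the long exact sequence is natural: every morphism of short exact sequences induces a morphism between the corresponding long exact sequences. -/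

import Mathlib

open CategoryTheory CategoryTheory.Limits
open scoped ZeroObject

universe v₁ v₂ u₁ u₂

namespace NonAdditive

section Categories

variable (C : Type u₁) [Category.{v₁} C] [HasZeroMorphisms C]

/-- The Split Short Five Lemma: given a morphism `(a, b, c)` between two split epimorphisms
(with chosen splittings) together with their kernels, if `a` and `c` are isomorphisms,
then so is `b`. For a pointed category with finite limits this is Bourn protomodularity. -/
def SplitShortFiveLemma : Prop :=
  ∀ ⦃K X Y K' X' Y' : C⦄ (k : K ⟶ X) (f : X ⟶ Y) (s : Y ⟶ X)
    (k' : K' ⟶ X') (f' : X' ⟶ Y') (s' : Y' ⟶ X')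
    (w : k ≫ f = 0) (w' : k' ≫ f' = 0)
    (_ : Nonempty (IsLimit (KernelFork.ofι k w))) (_ : Nonempty (IsLimit (KernelFork.ofι k' w')))
    (_ : s ≫ f = 𝟙 Y) (_ : s' ≫ f' = 𝟙 Y')
    (a : K ⟶ K') (b : X ⟶ X') (c : Y ⟶ Y')
    (_ : k ≫ b = a ≫ k') (_ : f ≫ c = b ≫ f') (_ : s ≫ b = c ≫ s')
    (_ : IsIso a) (_ : IsIso c), IsIso b

/-- A (Borceux–Bourn) homological category: pointed, regular and protomodular. -/
class Homological : Prop extends HasZeroObject C, Regular C where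
  splitShortFive : SplitShortFiveLemma C

end Categories

section Projectives

variable {C : Type u₁} [Category.{v₁} C]

/-- `P` is projective with respect to the class of regular epimorphisms. -/
def IsRegularProjective (P : C) : Prop :=
  ∀ ⦃X Y : C⦄ (p : X ⟶ Y) (_ : IsRegularEpi p) (f : P ⟶ Y), ∃ g : P ⟶ X, g ≫ p = f

variable (C) in
/-- Each object is a regular quotient of a (regular) projective object. -/
def HasEnoughRegularProjectives : Prop :=
  ∀ A : C, ∃ (P : C) (p : P ⟶ A), IsRegularProjective P ∧ IsRegularEpi p

variable [HasZeroMorphisms C]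

/-- `k` is a protosplit monomorphism: it is a kernel of a split epimorphism. -/
def IsProtosplitMono {K X : C} (k : K ⟶ X) : Prop :=
  ∃ (Y : C) (f : X ⟶ Y) (s : Y ⟶ X) (w : k ≫ f = 0),
    s ≫ f = 𝟙 Y ∧ Nonempty (IsLimit (KernelFork.ofι k w))

variable (C) in
/-- Condition (P): the class of projectives is closed under protosplit subobjects. -/
def ConditionP : Prop :=
  ∀ ⦃K X : C⦄ (k : K ⟶ X), IsProtosplitMono k → IsRegularProjective X → IsRegularProjective K

end Projectives

section Exactness

variable {C : Type u₁} [Category.{v₁} C] [HasZeroMorphisms C]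

/-- `0 ⟶ K ⟶ X ⟶ Y ⟶ 0` is a short exact sequence: `k` is a kernel of `f` and
`f` is a cokernel of `k`. -/
structure IsShortExact {K X Y : C} (k : K ⟶ X) (f : X ⟶ Y) : Prop where
  zero : k ≫ f = 0
  isKernel : Nonempty (IsLimit (KernelFork.ofι k zero))
  isCokernel : Nonempty (IsColimit (CokernelCofork.ofπ f zero))

/-- `f` is proper: a regular epimorphism followed by a normal monomorphism
(a kernel of some morphism). -/
def IsProper {X Y : C} (f : X ⟶ Y) : Prop :=
  ∃ (I : C) (e : X ⟶ I) (m : I ⟶ Y), IsRegularEpi e ∧ Nonempty (NormalMono m) ∧ e ≫ m = f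

/-- `A ⟶ B ⟶ D` is exact at `B`: the composite is zero and the lifting of the first morphism
over the kernel of the second one is a regular epimorphism. -/
def IsExactAt [HasKernels C] {A B D : C} (f : A ⟶ B) (g : B ⟶ D) : Prop :=
  ∃ w : f ≫ g = 0, IsRegularEpi (kernel.lift g f w)

end Exactness

section Functors

variable {C : Type u₁} [Category.{v₁} C] [HasZeroMorphisms C]
variable {E : Type u₂} [Category.{v₂} E] [HasZeroMorphisms E]

/-- `F` sends each short exact sequence `0 ⟶ K ⟶ X ⟶ Y ⟶ 0` to an exact sequence
`F K ⟶ F X ⟶ F Y ⟶ 0`. -/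
class SequentiallyRightExact [HasKernels E] (F : C ⥤ E) : Prop where
  exact : ∀ ⦃K X Y : C⦄ (k : K ⟶ X) (f : X ⟶ Y), IsShortExact k f →
    IsExactAt (F.map k) (F.map f) ∧ IsRegularEpi (F.map f)

/-- `F` sends kernels of split epimorphisms to monomorphisms. -/
def PreservesProtosplitMonos (F : C ⥤ E) : Prop :=
  ∀ ⦃K X : C⦄ (k : K ⟶ X), IsProtosplitMono k → Mono (F.map k)

/-- A sequentially right exact functor preserves zero morphisms, so that it can be applied
to chain complexes. -/
instance (priority := 100) preservesZeroMorphisms_of_sequentiallyRightExact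
    [HasZeroObject C] [HasZeroObject E] [HasKernels E]
    (F : C ⥤ E) [SequentiallyRightExact F] : F.PreservesZeroMorphisms := by
  have hz : IsZero (0 : C) := isZero_zero C
  have hs : IsShortExact (𝟙 (0 : C)) (𝟙 (0 : C)) :=
    { zero := hz.eq_of_src _ _
      isKernel := ⟨KernelFork.IsLimit.ofι _ _ (fun _ _ => hz.from_ _)
        (fun _ _ => hz.eq_of_tgt _ _) (fun _ _ _ _ => hz.eq_of_tgt _ _)⟩
      isCokernel := ⟨CokernelCofork.IsColimit.ofπ _ _ (fun _ _ => hz.to_ _)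
        (fun _ _ => hz.eq_of_src _ _) (fun _ _ _ _ => hz.eq_of_src _ _)⟩ }
  obtain ⟨⟨w, _⟩, _⟩ := SequentiallyRightExact.exact (F := F) _ _ hs
  have h0 : IsZero (F.obj (0 : C)) := by
    rw [IsZero.iff_id_eq_zero]
    rw [← F.map_id]
    simpa only [← F.map_comp, Category.comp_id] using w
  exact Functor.preservesZeroMorphisms_of_map_zero_object (h0.iso (isZero_zero E))

end Functors

section Resolutions

variable {C : Type u₁} [Category.{v₁} C] [HasZeroMorphisms C] [HasKernels C]

/-- A (regular) projective chain resolution of `X`: a positively graded chain complex of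
projective objects with a regular epimorphism `d₀ : C₀ ⟶ X`, such that for each `n ≥ 0` the
lifting of `d_{n+1}` over the kernel of `d_n` is a regular epimorphism. -/
structure ProjRes (X : C) where
  complex : ChainComplex C ℕ
  projective : ∀ n, IsRegularProjective (complex.X n)
  d₀ : complex.X 0 ⟶ X
  isRegularEpi_d₀ : IsRegularEpi d₀
  exact_zero : IsExactAt (complex.d 1 0) d₀
  exact_succ : ∀ n, IsExactAt (complex.d (n + 2) (n + 1)) (complex.d (n + 1) n)

/-- The chain morphism `φ` is a lifting of `x`. -/
def IsLifting {X Y : C} (x : X ⟶ Y) (P : ProjRes X) (Q : ProjRes Y)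
    (φ : P.complex ⟶ Q.complex) : Prop :=
  φ.f 0 ≫ Q.d₀ = P.d₀ ≫ x

/-- Lifting a morphism from a projective object through an exact pair. -/
theorem IsExactAt.exists_lift {A B D P : C} {f : A ⟶ B} {g : B ⟶ D} (h : IsExactAt f g)
    (hP : IsRegularProjective P) (t : P ⟶ B) (ht : t ≫ g = 0) : ∃ l : P ⟶ A, l ≫ f = t := by
  obtain ⟨w, hw⟩ := h
  obtain ⟨l, hl⟩ := hP _ hw (kernel.lift g t ht)
  refine ⟨l, ?_⟩
  have := congrArg (fun q => q ≫ kernel.ι g) hl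
  simpa using this

/-- Every morphism lifts to a morphism between given projective resolutions. -/
theorem exists_isLifting {X Y : C} (x : X ⟶ Y) (P : ProjRes X) (Q : ProjRes Y) :
    ∃ φ : P.complex ⟶ Q.complex, IsLifting x P Q φ := by
  obtain ⟨zero, hzero⟩ := P.projective 0 _ Q.isRegularEpi_d₀ (P.d₀ ≫ x)
  have hone : ∃ l : P.complex.X 1 ⟶ Q.complex.X 1,
      l ≫ Q.complex.d 1 0 = P.complex.d 1 0 ≫ zero :=
    Q.exact_zero.exists_lift (P.projective 1) _ (by
      obtain ⟨w, _⟩ := P.exact_zero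
      rw [Category.assoc, hzero, ← Category.assoc, w, zero_comp])
  obtain ⟨one, hone⟩ := hone
  have hsucc : ∀ (n : ℕ) (p : Σ' (f : P.complex.X n ⟶ Q.complex.X n)
      (f' : P.complex.X (n + 1) ⟶ Q.complex.X (n + 1)),
        f' ≫ Q.complex.d (n + 1) n = P.complex.d (n + 1) n ≫ f),
      ∃ f'' : P.complex.X (n + 2) ⟶ Q.complex.X (n + 2),
        f'' ≫ Q.complex.d (n + 2) (n + 1) = P.complex.d (n + 2) (n + 1) ≫ p.2.1 := fun n p =>
    (Q.exact_succ n).exists_lift (P.projective (n + 2)) _ (by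
      rw [Category.assoc, p.2.2, ← Category.assoc, HomologicalComplex.d_comp_d, zero_comp])
  exact ⟨ChainComplex.mkHom _ _ zero one hone
    (fun n p => ⟨(hsucc n p).choose, (hsucc n p).choose_spec⟩), hzero⟩

end Resolutions

section Derived

variable {C : Type u₁} [Category.{v₁} C] [HasZeroMorphisms C] [HasKernels C]
variable {E : Type u₂} [Category.{v₂} E] [HasZeroMorphisms E]
variable (F : C ⥤ E) [F.PreservesZeroMorphisms]

/-- The chain complex `F(C)`, for a projective resolution `C`. -/
noncomputable abbrev imageComplex {X : C} (P : ProjRes X) : ChainComplex E ℕ :=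
  (F.mapHomologicalComplex (ComplexShape.down ℕ)).obj P.complex

/-- `F` sends projective resolutions to proper chain complexes, and the homology objects of
these exist: for every `n`, the lifting of the differential `d_{n+1}` over the kernel `Z_n` of
`d_n` has a cokernel `H_n` (`ShortComplex.HasLeftHomology` says precisely this). -/
class HasResolutionHomology : Prop where
  isProper : ∀ {X : C} (P : ProjRes X) (n : ℕ), IsProper ((imageComplex F P).d (n + 1) n)
  hasLeftHomology : ∀ {X : C} (P : ProjRes X) (n : ℕ),
    ((imageComplex F P).sc n).HasLeftHomology

attribute [instance] HasResolutionHomology.hasLeftHomology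

variable [HasResolutionHomology F]

/-- `H_n(F(P))`, the cokernel of the lifting of `d_{n+1}` over the kernel `Z_n` of `d_n`. -/
noncomputable def resolutionHomology {X : C} (P : ProjRes X) (n : ℕ) : E :=
  ((imageComplex F P).sc n).leftHomology

/-- `H_n(F(φ))`. -/
noncomputable def resolutionHomologyMap {X Y : C} {P : ProjRes X} {Q : ProjRes Y}
    (φ : P.complex ⟶ Q.complex) (n : ℕ) :
    resolutionHomology F P n ⟶ resolutionHomology F Q n :=
  ShortComplex.leftHomologyMap ((HomologicalComplex.shortComplexFunctor E _ n).map
    ((F.mapHomologicalComplex (ComplexShape.down ℕ)).map φ))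

theorem resolutionHomologyMap_id {X : C} (P : ProjRes X) (n : ℕ) :
    resolutionHomologyMap F (𝟙 P.complex) n = 𝟙 (resolutionHomology F P n) := by
  unfold resolutionHomologyMap
  rw [CategoryTheory.Functor.map_id, CategoryTheory.Functor.map_id]
  exact ShortComplex.leftHomologyMap_id _

theorem resolutionHomologyMap_comp {X Y Z : C} {P : ProjRes X} {Q : ProjRes Y} {R : ProjRes Z}
    (φ : P.complex ⟶ Q.complex) (ψ : Q.complex ⟶ R.complex) (n : ℕ) :
    resolutionHomologyMap F (φ ≫ ψ) n =
      resolutionHomologyMap F φ n ≫ resolutionHomologyMap F ψ n := by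
  unfold resolutionHomologyMap
  rw [CategoryTheory.Functor.map_comp, CategoryTheory.Functor.map_comp]
  exact ShortComplex.leftHomologyMap_comp _ _

/-- Any two liftings of the same morphism induce the same morphism in homology after
applying `F`. This is what makes the left derived functors of `F` well defined. -/
class LiftingInvariant : Prop where
  eq : ∀ {X Y : C} (x : X ⟶ Y) {P : ProjRes X} {Q : ProjRes Y} (φ ψ : P.complex ⟶ Q.complex),
    IsLifting x P Q φ → IsLifting x P Q ψ →
      ∀ n : ℕ, resolutionHomologyMap F φ n = resolutionHomologyMap F ψ n

/-- The `n`th left derived functor `L_n(F)`, computed through a choice `R` of a projective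
resolution of each object: it sends `X` to `H_n(F(R X))` and `x` to `H_n(F(φ))`, for any
lifting `φ` of `x`. -/
noncomputable def leftDerived [LiftingInvariant F] (R : ∀ X : C, ProjRes X) (n : ℕ) : C ⥤ E where
  obj X := resolutionHomology F (R X) n
  map {X Y} x := resolutionHomologyMap F (exists_isLifting x (R X) (R Y)).choose n
  map_id X := by
    rw [← resolutionHomologyMap_id]
    exact LiftingInvariant.eq (𝟙 X) _ _ (exists_isLifting _ _ _).choose_spec
      (by simp [IsLifting]) n
  map_comp {X Y Z} x y := by
    rw [← resolutionHomologyMap_comp]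
    refine LiftingInvariant.eq (x ≫ y) _ _ (exists_isLifting _ _ _).choose_spec ?_ n
    have hx := (exists_isLifting x (R X) (R Y)).choose_spec
    have hy := (exists_isLifting y (R Y) (R Z)).choose_spec
    unfold IsLifting at hx hy ⊢
    rw [HomologicalComplex.comp_f, Category.assoc, hy, ← Category.assoc, hx, Category.assoc]

/-- The functors whose values occur in the long exact sequence:
`F` itself in degree `0`, and `L_n(F)` in each degree `n ≥ 1`. -/
noncomputable def sequenceTerm [LiftingInvariant F] (R : ∀ X : C, ProjRes X) : ℕ → (C ⥤ E)
  | 0 => F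
  | n + 1 => leftDerived F R (n + 1)

end Derived

end NonAdditive

open NonAdditive

/-!
Left derived functors are computed on towers of syzygies. A projective resolution `C` of `X` is cut
into short exact sequences `0 ⟶ Z (n + 1) ⟶ C n ⟶ Z n ⟶ 0` with `Z 0 = X` (`ProjRes.tower`; in a
homological category every regular epimorphism is the cokernel of its kernel). Sequential right
exactness of `F` identifies `H_0 (F C)` with `F X`, and `H_{n+1} (F C)` with the kernel of
`F (Z (n + 1)) ⟶ F (C n)` (`Tower.derived`, `exists_leftHomologyData`).

*Independence of the lifting.* Morphisms cannot be subtracted, but `f, g : X ⟶ Y` have an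
approximate difference `approxSub f g : diff X ⟶ Y` on the kernel `diff X` of the fold map
`X ⨿ X ⟶ X`. By protomodularity it vanishes only if `f = g` (`eq_of_approxSub_eq_zero`), and by
Condition (P) `diff X` is projective when `X` is. The usual construction of a chain homotopy
therefore works with iterated difference objects as domains (`Tower.IsProjective.exists_homotopy`).
As `F` preserves protosplit monomorphisms, `diff (F X)` maps to `F (diff X)` (`diffComparable`), so
that the homotopy can be used after applying `F` (`Tower.IsProjective.derivedMap_eq`). Only the
source tower has to be projective.

*The connecting morphism.* A short exact sequence `0 ⟶ K ⟶ X ⟶ Y ⟶ 0` spliced to a tower over `K`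
is a tower over `Y` whose derived objects are, up to a shift, those over `K`. The identity of `Y`
lifts from a projective tower over `Y` to this splice, and `Tower.connecting` is the induced
morphism. Its naturality is an instance of the independence of liftings.

*Exactness.* Let `0 ⟶ Ω ⟶ P ⟶ X ⟶ 0` be the first step of the tower over `X`, and `M` the kernel of
`P ⟶ Y`. The long exact sequence of `0 ⟶ Ω ⟶ M ⟶ K ⟶ 0` is that of `0 ⟶ K ⟶ X ⟶ Y ⟶ 0`, shifted by
two places (`Tower.exists_rotated_towers`). Exactness is thus reduced, by induction, to the lowest
degrees, where it is a diagram chase with generalized elements that rests on the regular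
epimorphism part of the Short Five Lemma (`exact_low_degree`).
-/

namespace NonAdditive

/-! ### Regular epimorphisms, kernels and exactness in homological categories -/

section Regular

variable {C : Type u₁} [Category.{v₁} C] [Regular C]

theorem isRegularEpi_comp {X Y Z : C} (f : X ⟶ Y) (g : Y ⟶ Z) [IsRegularEpi f]
    [IsRegularEpi g] : IsRegularEpi (f ≫ g) := by
  have := strongEpi_comp f g
  infer_instance

theorem isRegularEpi_of_comp {X Y Z : C} (f : X ⟶ Y) (g : Y ⟶ Z) [IsRegularEpi (f ≫ g)] :
    IsRegularEpi g := by
  have := strongEpi_of_strongEpi f g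
  infer_instance

theorem exists_regularEpi_mono_fac {X Y : C} (f : X ⟶ Y) :
    ∃ (I : C) (e : X ⟶ I) (m : I ⟶ Y), IsRegularEpi e ∧ Mono m ∧ e ≫ m = f :=
  ⟨_, (Regular.strongEpiMonoFactorisation f).e, (Regular.strongEpiMonoFactorisation f).m,
    inferInstance, inferInstance, (Regular.strongEpiMonoFactorisation f).fac⟩

/-- Lifting a generalized element through a regular epimorphism, locally. -/
theorem exists_local_lift {X Y W : C} (f : X ⟶ Y) [IsRegularEpi f] (t : W ⟶ Y) :
    ∃ (W' : C) (e : W' ⟶ W) (l : W' ⟶ X), IsRegularEpi e ∧ l ≫ f = e ≫ t :=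
  ⟨pullback f t, pullback.snd f t, pullback.fst f t, inferInstance, pullback.condition⟩

/-- A morphism that is locally surjective on generalized elements is a regular epimorphism. -/
theorem isRegularEpi_of_local_lift {X Y : C} (f : X ⟶ Y)
    (h : ∃ (W : C) (e : W ⟶ Y) (l : W ⟶ X), IsRegularEpi e ∧ l ≫ f = e) : IsRegularEpi f := by
  obtain ⟨W, e, l, he, rfl⟩ := h
  exact isRegularEpi_of_comp l f

end Regular

section Exact

theorem isIso_of_mono_of_isRegularEpi {C : Type u₁} [Category.{v₁} C] {X Y : C} (f : X ⟶ Y)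
    [Mono f] [h : IsRegularEpi f] : IsIso f :=
  isIso_of_regularEpi_of_mono f h.getStruct

theorem exists_pullback_lift {C : Type u₁} [Category.{v₁} C] [HasPullbacks C] {X Y Z W : C}
    (f : X ⟶ Z) (g : Y ⟶ Z) (a : W ⟶ X) (b : W ⟶ Y) (h : a ≫ f = b ≫ g) :
    ∃ l : W ⟶ pullback f g, l ≫ pullback.fst f g = a ∧ l ≫ pullback.snd f g = b :=
  ⟨pullback.lift a b h, pullback.lift_fst _ _ _, pullback.lift_snd _ _ _⟩

variable {C : Type u₁} [Category.{v₁} C] [HasZeroMorphisms C]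

theorem isKernel_of_lift {K X Y : C} {k : K ⟶ X} {f : X ⟶ Y} (w : k ≫ f = 0) [Mono k]
    (h : ∀ ⦃W : C⦄ (t : W ⟶ X), t ≫ f = 0 → ∃ l, l ≫ k = t) :
    Nonempty (IsLimit (KernelFork.ofι k w)) :=
  ⟨KernelFork.IsLimit.ofι k w (fun t ht => (h t ht).choose) (fun t ht => (h t ht).choose_spec)
    (fun t ht m hm => by rw [← cancel_mono k, hm, (h t ht).choose_spec])⟩

theorem exists_lift_of_isKernel {K X Y W : C} {k : K ⟶ X} {f : X ⟶ Y} {w : k ≫ f = 0}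
    (h : Nonempty (IsLimit (KernelFork.ofι k w))) (t : W ⟶ X) (ht : t ≫ f = 0) :
    ∃ l, l ≫ k = t :=
  h.elim fun h => ⟨h.lift (KernelFork.ofι t ht), h.fac _ WalkingParallelPair.zero⟩

theorem mono_of_isKernel {K X Y : C} {k : K ⟶ X} {f : X ⟶ Y} {w : k ≫ f = 0}
    (h : Nonempty (IsLimit (KernelFork.ofι k w))) : Mono k :=
  h.elim fun h => ⟨fun _ _ => Fork.IsLimit.hom_ext h⟩

namespace IsShortExact

variable {K X Y : C} {k : K ⟶ X} {f : X ⟶ Y}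

theorem mono (h : IsShortExact k f) : Mono k := mono_of_isKernel h.isKernel

theorem isRegularEpi (h : IsShortExact k f) : IsRegularEpi f :=
  h.isCokernel.elim fun h => ⟨⟨Cofork.IsColimit.regularEpi h⟩⟩

theorem exists_lift (h : IsShortExact k f) {W : C} (t : W ⟶ X) (ht : t ≫ f = 0) :
    ∃ l, l ≫ k = t :=
  exists_lift_of_isKernel h.isKernel t ht

end IsShortExact

/-- Exactness at the middle object, tested on generalized elements: each `t` killed by `g`
lifts along `f` after precomposition with a regular epimorphism. -/
theorem isExactAt_iff [Regular C] [HasKernels C] {A B D : C} (f : A ⟶ B) (g : B ⟶ D) :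
    IsExactAt f g ↔ f ≫ g = 0 ∧ ∀ ⦃W : C⦄ (t : W ⟶ B), t ≫ g = 0 →
      ∃ (W' : C) (e : W' ⟶ W) (l : W' ⟶ A), IsRegularEpi e ∧ l ≫ f = e ≫ t := by
  constructor
  · rintro ⟨w, h⟩
    refine ⟨w, fun W t ht => ?_⟩
    obtain ⟨W', e, l, he, hl⟩ := exists_local_lift (kernel.lift g f w) (kernel.lift g t ht)
    refine ⟨W', e, l, he, ?_⟩
    simpa using hl =≫ kernel.ι g
  · rintro ⟨w, h⟩
    refine ⟨w, isRegularEpi_of_local_lift _ ?_⟩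
    obtain ⟨W', e, l, he, hl⟩ := h (kernel.ι g) (kernel.condition g)
    exact ⟨W', e, l, he, by simp [← cancel_mono (kernel.ι g), hl]⟩

end Exact

section Homological

variable {C : Type u₁} [Category.{v₁} C] [HasZeroMorphisms C] [Homological C]

/-- A subobject that contains both the kernel and the section of a split epimorphism is the
whole object. -/
theorem isIso_of_mono_of_split {K X Y M : C} {k : K ⟶ X} {f : X ⟶ Y} {s : Y ⟶ X}
    {w : k ≫ f = 0} (hk : Nonempty (IsLimit (KernelFork.ofι k w))) (hs : s ≫ f = 𝟙 Y)
    (m : M ⟶ X) [Mono m] (k' : K ⟶ M) (hk' : k' ≫ m = k) (s' : Y ⟶ M) (hs' : s' ≫ m = s) :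
    IsIso m := by
  have hkm := mono_of_isKernel hk
  have hmk : Mono k' := by
    subst hk'
    exact mono_of_mono k' m
  have w' : k' ≫ m ≫ f = 0 := by rw [← Category.assoc, hk', w]
  have hker : Nonempty (IsLimit (KernelFork.ofι k' w')) := isKernel_of_lift w' fun W t ht => by
    obtain ⟨l, hl⟩ := exists_lift_of_isKernel hk (t ≫ m) (by simpa using ht)
    exact ⟨l, by rw [← cancel_mono m, Category.assoc, hk', hl]⟩
  exact Homological.splitShortFive k' (m ≫ f) s' k f s w' w hker hk
    (by rw [← Category.assoc, hs', hs]) hs (𝟙 K) m (𝟙 Y) (by simp [hk']) (by simp) (by simp [hs'])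
    inferInstance inferInstance

/-- The kernel and the section of a split epimorphism are jointly epimorphic. -/
theorem hom_ext_of_split {K X Y W : C} {k : K ⟶ X} {f : X ⟶ Y} {s : Y ⟶ X}
    {w : k ≫ f = 0} (hk : Nonempty (IsLimit (KernelFork.ofι k w))) (hs : s ≫ f = 𝟙 Y)
    {a b : X ⟶ W} (h₁ : k ≫ a = k ≫ b) (h₂ : s ≫ a = s ≫ b) : a = b := by
  have := isIso_of_mono_of_split hk hs (equalizer.ι a b) (equalizer.lift k h₁) (by simp)
    (equalizer.lift s h₂) (by simp)
  rw [← cancel_epi (equalizer.ι a b), equalizer.condition]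

/-- In a homological category, a regular epimorphism is the cokernel of its kernel. -/
theorem isShortExact_of_isRegularEpi {K X Y : C} {k : K ⟶ X} {f : X ⟶ Y} [IsRegularEpi f]
    (w : k ≫ f = 0) (hk : Nonempty (IsLimit (KernelFork.ofι k w))) : IsShortExact k f where
  zero := w
  isKernel := hk
  isCokernel := by
    have hkm := mono_of_isKernel hk
    -- a morphism killing `k` coequalizes the kernel pair of `f`, as it does so on the diagonal
    -- and on the kernel of the first projection
    have key : ∀ {Z : C} (g : X ⟶ Z), k ≫ g = 0 →
        pullback.fst f f ≫ g = pullback.snd f f ≫ g := by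
      intro Z g hg
      obtain ⟨κ, hκ₁, hκ₂⟩ := exists_pullback_lift f f (0 : K ⟶ X) k (by rw [w, zero_comp])
      obtain ⟨s, hs₁, hs₂⟩ := exists_pullback_lift f f (𝟙 X) (𝟙 X) rfl
      have : Mono κ := mono_of_mono_fac hκ₂
      refine hom_ext_of_split (isKernel_of_lift hκ₁ fun W t ht => ?_) hs₁ ?_ ?_
      · obtain ⟨l, hl⟩ := exists_lift_of_isKernel hk (t ≫ pullback.snd f f) (by
          rw [Category.assoc, ← pullback.condition, ← Category.assoc, ht, zero_comp])
        exact ⟨l, by apply pullback.hom_ext <;> simp only [Category.assoc, hκ₁, hκ₂, hl, ht,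
          comp_zero]⟩
      · rw [← Category.assoc, ← Category.assoc, hκ₁, hκ₂, hg, zero_comp]
      · rw [← Category.assoc, ← Category.assoc, hs₁, hs₂]
    have hreg := isColimitCoforkOfEffectiveEpi f _ (pullback.isLimit f f)
    have hdesc : ∀ {Z : C} (g : X ⟶ Z), k ≫ g = 0 → ∃ l, f ≫ l = g := fun g hg =>
      ⟨Cofork.IsColimit.desc hreg g (key g hg), Cofork.IsColimit.π_desc' hreg _ _⟩
    exact ⟨CokernelCofork.IsColimit.ofπ f w (fun g hg => (hdesc g hg).choose)
      (fun g hg => (hdesc g hg).choose_spec)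
      (fun g hg m hm => by rw [← cancel_epi f, hm, (hdesc g hg).choose_spec])⟩

/-- Mono part of the Short Five Lemma: a subobject `m` of `X` that contains the kernel of
`q : X ⟶ Y` and covers `Y` is the whole of `X`. -/
theorem isIso_of_mono_of_isRegularEpi_comp {K I X Y : C} {k : K ⟶ X} {q : X ⟶ Y}
    {w : k ≫ q = 0} (hk : Nonempty (IsLimit (KernelFork.ofι k w))) (m : I ⟶ X) [Mono m]
    [IsRegularEpi (m ≫ q)] (k' : K ⟶ I) (hk' : k' ≫ m = k) : IsIso m := by
  have hkm := mono_of_isKernel hk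
  -- after pulling back along `m ≫ q`, the epimorphism `q` splits
  obtain ⟨j, hj₁, hj₂⟩ := exists_pullback_lift (m ≫ q) q (pullback.fst (m ≫ q) (m ≫ q))
    (pullback.snd (m ≫ q) (m ≫ q) ≫ m) (by rw [pullback.condition, Category.assoc])
  have : Mono j := ⟨fun a b h => by
    apply pullback.hom_ext
    · rw [← hj₁, ← Category.assoc, h, Category.assoc]
    · rw [← cancel_mono m, Category.assoc, Category.assoc, ← hj₂, ← Category.assoc, h,
        Category.assoc]⟩
  obtain ⟨κ, hκ₁, hκ₂⟩ := exists_pullback_lift (m ≫ q) q (0 : K ⟶ I) k (by rw [w, zero_comp])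
  obtain ⟨κ', hκ'₁, hκ'₂⟩ := exists_pullback_lift (m ≫ q) (m ≫ q) (0 : K ⟶ I) k'
    (by rw [zero_comp, ← Category.assoc, hk', w])
  obtain ⟨s, hs₁, hs₂⟩ := exists_pullback_lift (m ≫ q) q (𝟙 I) m (Category.id_comp _)
  obtain ⟨s', hs'₁, hs'₂⟩ := exists_pullback_lift (m ≫ q) (m ≫ q) (𝟙 I) (𝟙 I) rfl
  have : Mono κ := mono_of_mono_fac hκ₂
  have hκ : Nonempty (IsLimit (KernelFork.ofι κ hκ₁)) := isKernel_of_lift hκ₁ fun W t ht => by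
    obtain ⟨l, hl⟩ := exists_lift_of_isKernel hk (t ≫ pullback.snd _ _) (by
      rw [Category.assoc, ← pullback.condition, ← Category.assoc, ht, zero_comp])
    exact ⟨l, by apply pullback.hom_ext <;> simp only [Category.assoc, hκ₁, hκ₂, hl, ht,
      comp_zero]⟩
  have : IsIso j := isIso_of_mono_of_split hκ hs₁ j κ'
    (by apply pullback.hom_ext
        · rw [Category.assoc, hj₁, hκ₁, hκ'₁]
        · rw [Category.assoc, hj₂, hκ₂, ← Category.assoc, hκ'₂, hk']) s'
    (by apply pullback.hom_ext
        · rw [Category.assoc, hj₁, hs₁, hs'₁]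
        · rw [Category.assoc, hj₂, hs₂, ← Category.assoc, hs'₂, Category.id_comp])
  have hfac : (inv j ≫ pullback.snd _ _) ≫ m = pullback.snd (m ≫ q) q := by
    rw [Category.assoc, ← hj₂, IsIso.inv_hom_id_assoc]
  have : IsRegularEpi ((inv j ≫ pullback.snd _ _) ≫ m) := by
    rw [hfac]
    infer_instance
  have := isRegularEpi_of_comp (inv j ≫ pullback.snd _ _) m
  exact isIso_of_mono_of_isRegularEpi m

/-- Regular epimorphism part of the Short Five Lemma: if `b ≫ q` is a regular epimorphism and
the image of `b` contains the kernel of `q`, then `b` is a regular epimorphism. -/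
theorem isRegularEpi_of_comp_of_kernel {A K X X' Y : C} {k : K ⟶ X'} {q : X' ⟶ Y}
    {w : k ≫ q = 0} (hk : Nonempty (IsLimit (KernelFork.ofι k w))) (b : X ⟶ X')
    [IsRegularEpi (b ≫ q)] (a : A ⟶ K) [IsRegularEpi a] (c : A ⟶ X) (h : a ≫ k = c ≫ b) :
    IsRegularEpi b := by
  obtain ⟨I, e, m, he, hm, rfl⟩ := exists_regularEpi_mono_fac b
  have : IsRegularEpi (e ≫ (m ≫ q)) := by rwa [← Category.assoc]
  have := isRegularEpi_of_comp e (m ≫ q)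
  have sq : CommSq (c ≫ e) a m k := ⟨by rw [h, Category.assoc]⟩
  have := isIso_of_mono_of_isRegularEpi_comp hk m sq.lift sq.fac_right
  exact isRegularEpi_comp e m

end Homological

/-! ### Difference objects and approximate differences -/

attribute [local simp] coprod.inl_desc coprod.inr_desc coprod.inl_desc_assoc
  coprod.inr_desc_assoc coprod.inl_map coprod.inr_map coprod.inl_map_assoc coprod.inr_map_assoc

section Difference

variable {C : Type u₁} [Category.{v₁} C] [HasZeroMorphisms C] [HasKernels C]
  [HasBinaryCoproducts C]

/-- The difference object of `X`: the kernel of the fold map `X ⨿ X ⟶ X`. For an object of an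
abelian category it is `X` itself, embedded by `(1, -1)`. -/
noncomputable abbrev diff (X : C) : C := kernel (coprod.desc (𝟙 X) (𝟙 X))

/-- The approximate difference of two parallel morphisms. -/
noncomputable def approxSub {X Y : C} (f g : X ⟶ Y) : diff X ⟶ Y :=
  kernel.ι _ ≫ coprod.desc f g

theorem approxSub_comp {X Y Z : C} (f g : X ⟶ Y) (h : Y ⟶ Z) :
    approxSub f g ≫ h = approxSub (f ≫ h) (g ≫ h) := by
  rw [approxSub, approxSub, Category.assoc]
  congr 1
  apply coprod.hom_ext <;> simp

theorem approxSub_self {X Y : C} (f : X ⟶ Y) : approxSub f f = 0 := by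
  have : coprod.desc f f = coprod.desc (𝟙 X) (𝟙 X) ≫ f := by
    apply coprod.hom_ext <;> simp
  rw [approxSub, this, kernel.condition_assoc, zero_comp]

/-- Functoriality of the difference object. -/
noncomputable def diffMap {X Y : C} (f : X ⟶ Y) : diff X ⟶ diff Y :=
  kernel.lift _ (kernel.ι _ ≫ coprod.map f f) (by
    have : coprod.map f f ≫ coprod.desc (𝟙 Y) (𝟙 Y) = coprod.desc (𝟙 X) (𝟙 X) ≫ f := by
      apply coprod.hom_ext <;> simp
    rw [Category.assoc, this, kernel.condition_assoc, zero_comp])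

theorem diffMap_ι {X Y : C} (f : X ⟶ Y) :
    diffMap f ≫ kernel.ι _ = kernel.ι _ ≫ coprod.map f f :=
  kernel.lift_ι _ _ _

theorem diffMap_approxSub {X Y Z : C} (t : X ⟶ Y) (f g : Y ⟶ Z) :
    diffMap t ≫ approxSub f g = approxSub (t ≫ f) (t ≫ g) := by
  rw [approxSub, ← Category.assoc, diffMap_ι, Category.assoc, coprod.map_desc, approxSub]

theorem diffMap_comp {X Y Z : C} (f : X ⟶ Y) (g : Y ⟶ Z) :
    diffMap (f ≫ g) = diffMap f ≫ diffMap g := by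
  rw [← cancel_mono (kernel.ι _), diffMap_ι, Category.assoc, diffMap_ι, ← Category.assoc,
    diffMap_ι, Category.assoc, coprod.map_map]

variable (C) in
/-- The difference object as an endofunctor. -/
noncomputable def diffFunctor : C ⥤ C where
  obj X := diff X
  map f := diffMap f
  map_id X := by simp [← cancel_mono (kernel.ι _), diffMap_ι]
  map_comp f g := diffMap_comp f g

theorem diffMap_zero (X Y : C) : diffMap (0 : X ⟶ Y) = 0 := by
  have : coprod.map (0 : X ⟶ Y) (0 : X ⟶ Y) = 0 := by apply coprod.hom_ext <;> simp
  rw [← cancel_mono (kernel.ι _), diffMap_ι, this, comp_zero, zero_comp]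

theorem approxSub_zero_right {X Y : C} (f : X ⟶ Y) :
    approxSub f 0 = approxSub (𝟙 X) 0 ≫ f := by
  rw [approxSub_comp, Category.id_comp, zero_comp]

theorem isProtosplitMono_diff (X : C) :
    IsProtosplitMono (kernel.ι (coprod.desc (𝟙 X) (𝟙 X))) :=
  ⟨X, _, coprod.inl, kernel.condition _, by simp, ⟨kernelIsKernel _⟩⟩

theorem isRegularProjective_diff (hP : ConditionP C) {X : C} (hX : IsRegularProjective X) :
    IsRegularProjective (diff X) := by
  refine hP _ (isProtosplitMono_diff X) fun A B p hp f => ?_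
  obtain ⟨g, hg⟩ := hX p hp (coprod.inl ≫ f)
  obtain ⟨h, hh⟩ := hX p hp (coprod.inr ≫ f)
  exact ⟨coprod.desc g h, by apply coprod.hom_ext <;> simp [hg, hh]⟩

end Difference

section DifferenceHomological

variable {C : Type u₁} [Category.{v₁} C] [HasZeroMorphisms C] [Homological C]
  [HasBinaryCoproducts C]

/-- The difference object, together with a coproduct inclusion, detects morphisms out of
`X ⨿ X`. -/
theorem coprod_hom_ext_of_diff {X Y : C} {a b : X ⨿ X ⟶ Y}
    (h : kernel.ι (coprod.desc (𝟙 X) (𝟙 X)) ≫ a = kernel.ι (coprod.desc (𝟙 X) (𝟙 X)) ≫ b)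
    (h' : coprod.inr ≫ a = coprod.inr ≫ b) : a = b :=
  hom_ext_of_split (w := kernel.condition (coprod.desc (𝟙 X) (𝟙 X))) ⟨kernelIsKernel _⟩
    (coprod.inr_desc _ _) h h'

theorem eq_of_approxSub_eq_zero {X Y : C} {f g : X ⟶ Y} (h : approxSub f g = 0) : f = g := by
  have : coprod.desc f g = coprod.desc g g :=
    coprod_hom_ext_of_diff (h.trans (approxSub_self g).symm) (by simp)
  simpa using coprod.inl ≫= this

instance epi_approxSub_id_zero (X : C) : Epi (approxSub (𝟙 X) 0) where
  left_cancellation f g h := by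
    rw [← approxSub_zero_right, ← approxSub_zero_right] at h
    have : coprod.desc f 0 = coprod.desc g 0 := coprod_hom_ext_of_diff h (by simp)
    simpa using coprod.inl ≫= this

end DifferenceHomological

section DifferencePower

variable (C : Type u₁) [Category.{v₁} C] [HasZeroMorphisms C] [HasKernels C]
  [HasBinaryCoproducts C]

/-- The `(n + 1)`-fold iterate of the difference object functor. -/
noncomputable def diffPow : ℕ → (C ⥤ C)
  | 0 => diffFunctor C
  | n + 1 => diffPow n ⋙ diffFunctor C

theorem diffPow_map_zero (n : ℕ) (X Y : C) : (diffPow C n).map (0 : X ⟶ Y) = 0 := by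
  induction n with
  | zero => exact diffMap_zero X Y
  | succ n ih => exact (congrArg diffMap ih).trans (diffMap_zero _ _)

variable {C} in
theorem isRegularProjective_diffPow (hP : ConditionP C) (n : ℕ) {X : C}
    (hX : IsRegularProjective X) : IsRegularProjective ((diffPow C n).obj X) := by
  induction n with
  | zero => exact isRegularProjective_diff hP hX
  | succ n ih => exact isRegularProjective_diff hP ih

/-- The projection from an iterated difference object to the difference object, taking
differences with zero. -/
noncomputable def diffPowProj : ∀ (n : ℕ) (X : C), (diffPow C n).obj X ⟶ diff X
  | 0, X => 𝟙 (diff X)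
  | n + 1, X => approxSub (𝟙 ((diffPow C n).obj X)) 0 ≫ diffPowProj n X

variable {C} in
theorem diffMap_approxSub_id_zero {X Y : C} (f : X ⟶ Y) :
    diffMap f ≫ approxSub (𝟙 Y) 0 = approxSub (𝟙 X) 0 ≫ f := by
  rw [diffMap_approxSub, approxSub_comp, Category.comp_id, comp_zero, Category.id_comp, zero_comp]

variable {C} in
theorem diffPowProj_naturality (n : ℕ) {X Y : C} (f : X ⟶ Y) :
    (diffPow C n).map f ≫ diffPowProj C n Y = diffPowProj C n X ≫ diffMap f := by
  induction n with
  | zero => exact (Category.comp_id _).trans (Category.id_comp _).symm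
  | succ n ih =>
    change diffMap ((diffPow C n).map f) ≫ approxSub (𝟙 _) 0 ≫ diffPowProj C n Y =
      (approxSub (𝟙 _) 0 ≫ diffPowProj C n X) ≫ diffMap f
    rw [← Category.assoc, diffMap_approxSub_id_zero, Category.assoc, Category.assoc, ih]

end DifferencePower

theorem epi_diffPowProj {C : Type u₁} [Category.{v₁} C] [HasZeroMorphisms C] [Homological C]
    [HasBinaryCoproducts C] (n : ℕ) (X : C) : Epi (diffPowProj C n X) := by
  induction n with
  | zero => exact inferInstanceAs (Epi (𝟙 (diff X)))
  | succ n ih => exact epi_comp (approxSub (𝟙 ((diffPow C n).obj X)) 0) _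

theorem coprodComparison_map_desc {C : Type u₁} [Category.{v₁} C]
    [HasBinaryCoproducts C] {E : Type u₂} [Category.{v₂} E] [HasBinaryCoproducts E] (F : C ⥤ E)
    {X Y Z : C} (f : X ⟶ Z) (g : Y ⟶ Z) :
    coprodComparison F X Y ≫ F.map (coprod.desc f g) = coprod.desc (F.map f) (F.map g) := by
  rw [coprodComparison, coprod.desc_comp, ← F.map_comp, ← F.map_comp, coprod.inl_desc,
    coprod.inr_desc]

section Comparison

variable {C : Type u₁} [Category.{v₁} C] [HasZeroMorphisms C] [HasKernels C]
  [HasBinaryCoproducts C]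
variable {E : Type u₂} [Category.{v₂} E] [HasZeroMorphisms E] [HasKernels E]
  [HasBinaryCoproducts E]
variable (F : C ⥤ E)

/-- `F` commutes with difference objects, at least up to a comparison morphism over
`F (X ⨿ X)`. -/
def DiffComparable : Prop :=
  ∀ X : C, ∃ θ : diff (F.obj X) ⟶ F.obj (diff X),
    θ ≫ F.map (kernel.ι _) = kernel.ι _ ≫ coprodComparison F X X

variable {F} (hF : DiffComparable F)

/-- The comparison morphism from the difference object of `F X` to the value of `F` at the
difference object of `X`. -/
noncomputable def diffComparison (X : C) : diff (F.obj X) ⟶ F.obj (diff X) := (hF X).choose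

theorem diffComparison_approxSub {X Y : C} (f g : X ⟶ Y) :
    diffComparison hF X ≫ F.map (approxSub f g) = approxSub (F.map f) (F.map g) := by
  rw [approxSub, F.map_comp, ← Category.assoc, diffComparison, (hF X).choose_spec,
    Category.assoc, approxSub, coprodComparison_map_desc]

theorem diffComparison_naturality (hmono : PreservesProtosplitMonos F) {X Y : C} (f : X ⟶ Y) :
    diffMap (F.map f) ≫ diffComparison hF Y = diffComparison hF X ≫ F.map (diffMap f) := by
  have := hmono _ (isProtosplitMono_diff Y)
  rw [← cancel_mono (F.map (kernel.ι (coprod.desc (𝟙 Y) (𝟙 Y)))), Category.assoc, Category.assoc,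
    ← F.map_comp, diffMap_ι, F.map_comp, diffComparison, (hF Y).choose_spec, ← Category.assoc,
    diffMap_ι, Category.assoc, diffComparison, ← Category.assoc (hF X).choose, (hF X).choose_spec,
    Category.assoc, coprodComparison_natural]

/-- The comparison morphism for iterated difference objects. -/
noncomputable def diffPowComparison (hF : DiffComparable F) :
    ∀ (n : ℕ) (X : C), (diffPow E n).obj (F.obj X) ⟶ F.obj ((diffPow C n).obj X)
  | 0, X => diffComparison hF X
  | n + 1, X => diffMap (diffPowComparison hF n X) ≫ diffComparison hF ((diffPow C n).obj X)

theorem diffPowComparison_naturality (hmono : PreservesProtosplitMonos F) (n : ℕ) {X Y : C}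
    (f : X ⟶ Y) :
    (diffPow E n).map (F.map f) ≫ diffPowComparison hF n Y =
      diffPowComparison hF n X ≫ F.map ((diffPow C n).map f) := by
  induction n with
  | zero => exact diffComparison_naturality hF hmono f
  | succ n ih =>
    change diffMap ((diffPow E n).map (F.map f)) ≫ diffMap (diffPowComparison hF n Y) ≫
        diffComparison hF _ =
      (diffMap (diffPowComparison hF n X) ≫ diffComparison hF _) ≫
        F.map (diffMap ((diffPow C n).map f))
    rw [Category.assoc, ← diffComparison_naturality hF hmono, ← Category.assoc, ← Category.assoc,
      ← diffMap_comp, ← diffMap_comp, ih]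

theorem diffPowComparison_proj [F.PreservesZeroMorphisms] (n : ℕ) (X : C) :
    diffPowComparison hF n X ≫ F.map (diffPowProj C n X) =
      diffPowProj E n (F.obj X) ≫ diffComparison hF X := by
  induction n with
  | zero =>
    change diffComparison hF X ≫ F.map (𝟙 (diff X)) = 𝟙 (diff (F.obj X)) ≫ diffComparison hF X
    rw [F.map_id, Category.comp_id, Category.id_comp]
  | succ n ih =>
    change (diffMap (diffPowComparison hF n X) ≫ diffComparison hF _) ≫
        F.map (approxSub (𝟙 _) 0 ≫ diffPowProj C n X) =
      (approxSub (𝟙 _) 0 ≫ diffPowProj E n (F.obj X)) ≫ diffComparison hF X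
    rw [F.map_comp, Category.assoc,
      ← Category.assoc (diffComparison hF _), diffComparison_approxSub, F.map_id, F.map_zero,
      ← Category.assoc, diffMap_approxSub_id_zero, Category.assoc, ih, Category.assoc]

end Comparison

/-- The difference object of `F X` maps to `F (diff X)`, because `F` keeps the sequence
`diff X ⟶ X ⨿ X ⟶ X` exact and its first morphism a monomorphism. -/
theorem diffComparable {C : Type u₁} [Category.{v₁} C] [HasZeroMorphisms C] [Homological C]
    [HasBinaryCoproducts C] {E : Type u₂} [Category.{v₂} E] [HasZeroMorphisms E] [Homological E]
    [HasBinaryCoproducts E] (F : C ⥤ E) [SequentiallyRightExact F]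
    (hmono : PreservesProtosplitMonos F) : DiffComparable F := by
  intro X
  have : IsSplitEpi (coprod.desc (𝟙 X) (𝟙 X)) := ⟨⟨⟨coprod.inl, by simp⟩⟩⟩
  obtain ⟨⟨w, hw⟩, -⟩ := SequentiallyRightExact.exact (F := F) _ _
    (isShortExact_of_isRegularEpi (kernel.condition (coprod.desc (𝟙 X) (𝟙 X)))
      ⟨kernelIsKernel _⟩)
  have := hmono _ (isProtosplitMono_diff X)
  have : Mono (kernel.lift _ _ w) := mono_of_mono_fac (kernel.lift_ι _ _ w)
  have := isIso_of_mono_of_isRegularEpi (kernel.lift _ _ w)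
  refine ⟨kernel.lift _ (kernel.ι _ ≫ coprodComparison F X X) ?_ ≫ inv (kernel.lift _ _ w), ?_⟩
  · have : coprodComparison F X X ≫ F.map (coprod.desc (𝟙 X) (𝟙 X)) =
        coprod.desc (𝟙 _) (𝟙 _) := by
      rw [coprodComparison_map_desc, F.map_id]
    rw [Category.assoc, this, kernel.condition]
  · have : inv (kernel.lift _ _ w) ≫ F.map (kernel.ι (coprod.desc (𝟙 X) (𝟙 X))) = kernel.ι _ := by
      rw [IsIso.inv_comp_eq, kernel.lift_ι]
    rw [Category.assoc, this, kernel.lift_ι]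

/-! ### Towers of short exact sequences and their derived objects -/

section Towers

variable (C : Type u₁) [Category.{v₁} C] [HasZeroMorphisms C]

/-- A tower of short exact sequences `0 ⟶ Z (n + 1) ⟶ P n ⟶ Z n ⟶ 0`. This is an exact
augmented chain complex `⋯ ⟶ P 1 ⟶ P 0 ⟶ Z 0` together with its syzygies `Z (n + 1)`. -/
structure Tower where
  /-- the augmentation object `Z 0` and the syzygies `Z (n + 1)` -/
  Z : ℕ → C
  /-- the objects of the chain complex -/
  P : ℕ → C
  /-- the inclusion of a syzygy -/
  i (n : ℕ) : Z (n + 1) ⟶ P n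
  /-- the projection to the previous syzygy -/
  p (n : ℕ) : P n ⟶ Z n
  exact (n : ℕ) : IsShortExact (i n) (p n)

namespace Tower

variable {C}

/-- A morphism of towers. -/
structure Hom (T T' : Tower C) where
  /-- the components on syzygies -/
  z (n : ℕ) : T.Z n ⟶ T'.Z n
  /-- the components on chain objects -/
  c (n : ℕ) : T.P n ⟶ T'.P n
  i_c (n : ℕ) : T.i n ≫ c n = z (n + 1) ≫ T'.i n
  p_z (n : ℕ) : T.p n ≫ z n = c n ≫ T'.p n

/-- The identity morphism of a tower. -/
def Hom.id (T : Tower C) : Hom T T where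
  z _ := 𝟙 _
  c _ := 𝟙 _
  i_c n := by rw [Category.comp_id, Category.id_comp]
  p_z n := by rw [Category.comp_id, Category.id_comp]

/-- Composition of morphisms of towers. -/
def Hom.comp {T T' T'' : Tower C} (φ : Hom T T') (ψ : Hom T' T'') : Hom T T'' where
  z n := φ.z n ≫ ψ.z n
  c n := φ.c n ≫ ψ.c n
  i_c n := by rw [← Category.assoc, φ.i_c, Category.assoc, ψ.i_c, Category.assoc]
  p_z n := by rw [← Category.assoc, φ.p_z, Category.assoc, ψ.p_z, Category.assoc]

/-- The tower starting at the first syzygy. -/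
def tail (T : Tower C) : Tower C where
  Z n := T.Z (n + 1)
  P n := T.P (n + 1)
  i n := T.i (n + 1)
  p n := T.p (n + 1)
  exact n := T.exact (n + 1)

/-- The restriction of a morphism to the tails. -/
def Hom.tail {T T' : Tower C} (φ : Hom T T') : Hom T.tail T'.tail where
  z n := φ.z (n + 1)
  c n := φ.c (n + 1)
  i_c n := φ.i_c (n + 1)
  p_z n := φ.p_z (n + 1)

/-- The tower obtained by splicing a short exact sequence whose kernel object is `T.Z 0` to the
left end of `T`. -/
def splice (T : Tower C) {X Y : C} (k : T.Z 0 ⟶ X) (f : X ⟶ Y) (h : IsShortExact k f) :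
    Tower C where
  Z
    | 0 => Y
    | n + 1 => T.Z n
  P
    | 0 => X
    | n + 1 => T.P n
  i
    | 0 => k
    | n + 1 => T.i n
  p
    | 0 => f
    | n + 1 => T.p n
  exact
    | 0 => h
    | n + 1 => T.exact n

/-- Extending a morphism `ψ : T.tail ⟶ T'.tail` to a morphism of towers. -/
def Hom.cons {T T' : Tower C} (ψ : Hom T.tail T'.tail) (z : T.Z 0 ⟶ T'.Z 0) (c : T.P 0 ⟶ T'.P 0)
    (hi : T.i 0 ≫ c = ψ.z 0 ≫ T'.i 0) (hp : T.p 0 ≫ z = c ≫ T'.p 0) : Hom T T' where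
  z
    | 0 => z
    | n + 1 => ψ.z n
  c
    | 0 => c
    | n + 1 => ψ.c n
  i_c
    | 0 => hi
    | n + 1 => ψ.i_c n
  p_z
    | 0 => hp
    | n + 1 => ψ.p_z n

/-- A tower is projective if all its chain objects are (its augmentation object and syzygies
need not be). -/
def IsProjective (T : Tower C) : Prop := ∀ n, IsRegularProjective (T.P n)

theorem IsProjective.tail {T : Tower C} (h : T.IsProjective) : T.tail.IsProjective :=
  fun n => h (n + 1)

theorem IsProjective.splice {T : Tower C} (h : T.IsProjective) {X Y : C} (k : T.Z 0 ⟶ X)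
    (f : X ⟶ Y) (hkf : IsShortExact k f) (hX : IsRegularProjective X) :
    (T.splice k f hkf).IsProjective
  | 0 => hX
  | n + 1 => h n

theorem IsProjective.exists_hom {T : Tower C} (h : T.IsProjective) (T' : Tower C)
    (x : T.Z 0 ⟶ T'.Z 0) : ∃ φ : Hom T T', φ.z 0 = x := by
  have step : ∀ (n : ℕ) (z : T.Z n ⟶ T'.Z n), ∃ (c : T.P n ⟶ T'.P n)
      (z' : T.Z (n + 1) ⟶ T'.Z (n + 1)), T.p n ≫ z = c ≫ T'.p n ∧ T.i n ≫ c = z' ≫ T'.i n := by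
    intro n z
    obtain ⟨c, hc⟩ := h n _ (T'.exact n).isRegularEpi (T.p n ≫ z)
    obtain ⟨z', hz'⟩ := (T'.exact n).exists_lift (T.i n ≫ c) (by
      rw [Category.assoc, hc, ← Category.assoc, (T.exact n).zero, zero_comp])
    exact ⟨c, z', hc.symm, hz'.symm⟩
  choose c z' hp hi using step
  let z : ∀ n, T.Z n ⟶ T'.Z n := fun n => Nat.rec x (fun n z => z' n z) n
  exact ⟨⟨z, fun n => c n (z n), fun n => hi n (z n), fun n => hp n (z n)⟩, rfl⟩

end Tower

end Towers

theorem exists_projective_tower {C : Type u₁} [Category.{v₁} C] [HasZeroMorphisms C]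
    [Homological C] (hproj : HasEnoughRegularProjectives C) (X : C) :
    ∃ T : Tower C, T.IsProjective ∧ T.Z 0 = X := by
  have step : ∀ Z : C, ∃ (P Z' : C) (i : Z' ⟶ P) (p : P ⟶ Z), IsRegularProjective P ∧
      IsShortExact i p := fun Z => by
    obtain ⟨P, p, hP, hp⟩ := hproj Z
    exact ⟨P, _, kernel.ι p, p, hP,
      isShortExact_of_isRegularEpi (kernel.condition p) ⟨kernelIsKernel p⟩⟩
  choose P Z' i p hP h using step
  let Z : ℕ → C := fun n => Nat.rec X (fun _ Z => Z' Z) n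
  exact ⟨⟨Z, fun n => P (Z n), fun n => i (Z n), fun n => p (Z n), fun n => h (Z n)⟩,
    fun n => hP (Z n), rfl⟩

namespace Tower

section Derived

variable {C : Type u₁} [Category.{v₁} C] [HasZeroMorphisms C]
variable {E : Type u₂} [Category.{v₂} E] [HasZeroMorphisms E] [HasKernels E]
variable (F : C ⥤ E)

/-- The derived objects of `F` on a tower: the value of `F` in degree `0`, and the kernel of
`F (Z (n + 1)) ⟶ F (P n)` in degree `n + 1`. -/
noncomputable def derived (T : Tower C) : ℕ → E
  | 0 => F.obj (T.Z 0)
  | n + 1 => kernel (F.map (T.i n))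

/-- The action of a morphism of towers on derived objects. -/
noncomputable def Hom.derivedMap {T T' : Tower C} (φ : Hom T T') :
    ∀ n, T.derived F n ⟶ T'.derived F n
  | 0 => F.map (φ.z 0)
  | n + 1 => kernel.map (F.map (T.i n)) (F.map (T'.i n)) (F.map (φ.z (n + 1))) (F.map (φ.c n))
      (by rw [← F.map_comp, ← F.map_comp, φ.i_c])

/-- The inclusion of a derived object of positive degree into the value of `F` at a syzygy. -/
noncomputable def derivedι (T : Tower C) (n : ℕ) : T.derived F (n + 1) ⟶ F.obj (T.Z (n + 1)) :=
  kernel.ι (F.map (T.i n))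

instance mono_derivedι (T : Tower C) (n : ℕ) : Mono (T.derivedι F n) :=
  inferInstanceAs (Mono (kernel.ι (F.map (T.i n))))

theorem derivedι_map (T : Tower C) (n : ℕ) : T.derivedι F n ≫ F.map (T.i n) = 0 :=
  kernel.condition _

theorem exists_derived_lift (T : Tower C) (n : ℕ) {W : E} (t : W ⟶ F.obj (T.Z (n + 1)))
    (ht : t ≫ F.map (T.i n) = 0) : ∃ l : W ⟶ T.derived F (n + 1), l ≫ T.derivedι F n = t :=
  ⟨kernel.lift _ t ht, kernel.lift_ι _ _ _⟩

theorem Hom.derivedMap_succ_ι {T T' : Tower C} (φ : Hom T T') (n : ℕ) :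
    φ.derivedMap F (n + 1) ≫ T'.derivedι F n = T.derivedι F n ≫ F.map (φ.z (n + 1)) :=
  kernel.lift_ι _ _ _

theorem Hom.derivedMap_id (T : Tower C) (n : ℕ) :
    (Hom.id T).derivedMap F n = 𝟙 (T.derived F n) := by
  cases n with
  | zero => exact F.map_id _
  | succ n =>
    rw [← cancel_mono (T.derivedι F n), Hom.derivedMap_succ_ι, Category.id_comp]
    exact (congrArg _ (F.map_id _)).trans (Category.comp_id _)

theorem Hom.derivedMap_comp {T T' T'' : Tower C} (φ : Hom T T') (ψ : Hom T' T'') (n : ℕ) :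
    (φ.comp ψ).derivedMap F n = φ.derivedMap F n ≫ ψ.derivedMap F n := by
  cases n with
  | zero => exact F.map_comp _ _
  | succ n =>
    rw [← cancel_mono (T''.derivedι F n), Hom.derivedMap_succ_ι, Category.assoc,
      Hom.derivedMap_succ_ι, ← Category.assoc, Hom.derivedMap_succ_ι, Category.assoc,
      ← F.map_comp]
    rfl

/-- Dimension shifting: the derived objects of a tower embed into those of its tail, by the
identity except in the lowest degree. -/
noncomputable def shift (T : Tower C) : ∀ n, T.derived F (n + 1) ⟶ T.tail.derived F n
  | 0 => T.derivedι F 0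
  | n + 1 => 𝟙 (T.derived F (n + 2))

instance mono_shift (T : Tower C) (n : ℕ) : Mono (T.shift F n) := by
  cases n with
  | zero => exact mono_derivedι F T 0
  | succ n => exact inferInstanceAs (Mono (𝟙 (T.derived F (n + 2))))

instance isIso_shift_succ (T : Tower C) (n : ℕ) : IsIso (T.shift F (n + 1)) :=
  inferInstanceAs (IsIso (𝟙 (T.derived F (n + 2))))

theorem Hom.shift_naturality {T T' : Tower C} (φ : Hom T T') (n : ℕ) :
    φ.derivedMap F (n + 1) ≫ T'.shift F n = T.shift F n ≫ φ.tail.derivedMap F n := by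
  cases n with
  | zero => exact Hom.derivedMap_succ_ι F φ 0
  | succ n => exact (Category.comp_id _).trans (Category.id_comp _).symm

end Derived

section Homotopy

variable {C : Type u₁} [Category.{v₁} C] [HasZeroMorphisms C] [HasKernels C]
  [HasBinaryCoproducts C]

/-- Two morphisms from a projective tower with the same augmentation are homotopic in the
approximate sense: on syzygies, their difference extends over the chain objects, after
replacing difference objects by iterated ones. -/
theorem IsProjective.exists_homotopy (hP : ConditionP C) {T T' : Tower C} (hT : T.IsProjective)
    (φ ψ : Hom T T') (h : φ.z 0 = ψ.z 0) (n : ℕ) :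
    ∃ u : (diffPow C n).obj (T.P n) ⟶ T'.Z (n + 1),
      (diffPow C n).map (T.i n) ≫ u =
        diffPowProj C n _ ≫ approxSub (φ.z (n + 1)) (ψ.z (n + 1)) := by
  induction n with
  | zero =>
    obtain ⟨u, hu⟩ := (T'.exact 0).exists_lift (approxSub (φ.c 0) (ψ.c 0)) (by
      rw [approxSub_comp, ← φ.p_z, ← ψ.p_z, h, approxSub_self])
    refine ⟨u, ?_⟩
    have := (T'.exact 0).mono
    rw [← cancel_mono (T'.i 0)]
    change (diffMap (T.i 0) ≫ u) ≫ T'.i 0 =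
      (𝟙 (diff (T.Z 1)) ≫ approxSub (φ.z 1) (ψ.z 1)) ≫ T'.i 0
    rw [Category.assoc, hu, diffMap_approxSub, Category.id_comp, approxSub_comp, φ.i_c, ψ.i_c]
  | succ n ih =>
    obtain ⟨u, hu⟩ := ih
    obtain ⟨v, hv⟩ := isRegularProjective_diffPow hP n (hT n) _ (T'.exact (n + 1)).isRegularEpi u
    -- the difference of `φ` and `ψ` and the composite of the previous homotopy with the
    -- differential of `T` agree after projection to `T'.Z (n + 1)`
    let d := diffPowProj C n (T.P (n + 1)) ≫ approxSub (φ.c (n + 1)) (ψ.c (n + 1))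
    let w := (diffPow C n).map (T.p (n + 1) ≫ T.i n) ≫ v
    have hdw : d ≫ T'.p (n + 1) = w ≫ T'.p (n + 1) := by
      simp only [d, w]
      rw [Category.assoc, approxSub_comp, ← φ.p_z, ← ψ.p_z, ← diffMap_approxSub, Category.assoc,
        hv, Functor.map_comp, Category.assoc, hu, ← Category.assoc, ← diffPowProj_naturality,
        Category.assoc]
    obtain ⟨u', hu'⟩ := (T'.exact (n + 1)).exists_lift (approxSub d w) (by
      rw [approxSub_comp, hdw, approxSub_self])
    refine ⟨u', ?_⟩
    have := (T'.exact (n + 1)).mono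
    rw [← cancel_mono (T'.i (n + 1))]
    have h₁ : (diffPow C n).map (T.i (n + 1)) ≫ w = 0 := by
      simp only [w]
      rw [← Category.assoc, ← Functor.map_comp, ← Category.assoc, (T.exact (n + 1)).zero,
        zero_comp, diffPow_map_zero, zero_comp]
    have h₂ : (diffPow C n).map (T.i (n + 1)) ≫ d = diffPowProj C n _ ≫
        approxSub (φ.z (n + 2)) (ψ.z (n + 2)) ≫ T'.i (n + 1) := by
      simp only [d]
      rw [← Category.assoc, diffPowProj_naturality, Category.assoc, diffMap_approxSub, φ.i_c,
        ψ.i_c, approxSub_comp]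
    change (diffMap ((diffPow C n).map (T.i (n + 1))) ≫ u') ≫ T'.i (n + 1) =
      ((approxSub (𝟙 _) 0 ≫ diffPowProj C n _) ≫ approxSub (φ.z (n + 2)) (ψ.z (n + 2))) ≫
        T'.i (n + 1)
    rw [Category.assoc, hu', diffMap_approxSub, h₁, h₂, approxSub_zero_right, Category.assoc,
      Category.assoc]

end Homotopy

section Invariance

variable {C : Type u₁} [Category.{v₁} C] [HasZeroMorphisms C] [HasKernels C]
  [HasBinaryCoproducts C]
variable {E : Type u₂} [Category.{v₂} E] [HasZeroMorphisms E] [Homological E]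
  [HasBinaryCoproducts E]
variable {F : C ⥤ E} [F.PreservesZeroMorphisms]

/-- The action of a morphism of towers with projective domain on derived objects only depends on
its augmentation. -/
theorem IsProjective.derivedMap_eq (hP : ConditionP C) (hF : DiffComparable F)
    (hmono : PreservesProtosplitMonos F) {T T' : Tower C} (hT : T.IsProjective) (φ ψ : Hom T T')
    (h : φ.z 0 = ψ.z 0) (n : ℕ) : φ.derivedMap F n = ψ.derivedMap F n := by
  cases n with
  | zero => exact congrArg F.map h
  | succ n =>
    obtain ⟨u, hu⟩ := hT.exists_homotopy hP φ ψ h n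
    rw [← cancel_mono (T'.derivedι F n), Hom.derivedMap_succ_ι, Hom.derivedMap_succ_ι]
    apply eq_of_approxSub_eq_zero
    have := epi_diffPowProj (C := E) n (T.derived F (n + 1))
    rw [← cancel_epi (diffPowProj E n (T.derived F (n + 1))), comp_zero, ← diffMap_approxSub,
      ← diffComparison_approxSub hF, ← Category.assoc, ← Category.assoc,
      ← diffPowProj_naturality, Category.assoc ((diffPow E n).map _), ← diffPowComparison_proj,
      Category.assoc, Category.assoc, ← F.map_comp, ← hu, F.map_comp,
      ← Category.assoc (diffPowComparison hF n _), ← diffPowComparison_naturality hF hmono,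
      ← Category.assoc, ← Category.assoc, ← Functor.map_comp, derivedι_map, diffPow_map_zero,
      zero_comp, zero_comp]

end Invariance

end Tower

/-! ### The long exact sequence of derived objects -/

section ExactTransfer

variable {C : Type u₁} [Category.{v₁} C] [HasZeroMorphisms C] [Regular C] [HasKernels C]

/-- Exactness descends to subobjects of the middle and the last object, if the first object
is replaced by a cover of it. -/
theorem IsExactAt.of_mono {A B D A' B' D' : C} {f' : A' ⟶ B'} {g' : B' ⟶ D'}
    (h : IsExactAt f' g') {f : A ⟶ B} {g : B ⟶ D} (r : A ⟶ A') (s : B ⟶ B') (t : D ⟶ D')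
    [IsRegularEpi r] [Mono s] [Mono t] (hf : f ≫ s = r ≫ f') (hg : g ≫ t = s ≫ g') :
    IsExactAt f g := by
  rw [isExactAt_iff] at h ⊢
  obtain ⟨w, h⟩ := h
  refine ⟨?_, fun W x hx => ?_⟩
  · rw [← cancel_mono t, Category.assoc, hg, ← Category.assoc, hf, Category.assoc, w, comp_zero,
      zero_comp]
  · obtain ⟨W₁, e₁, l₁, he₁, hl₁⟩ := h (x ≫ s) (by
      rw [Category.assoc, ← hg, ← Category.assoc, hx, zero_comp])
    obtain ⟨W₂, e₂, l₂, he₂, hl₂⟩ := exists_local_lift r l₁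
    refine ⟨W₂, e₂ ≫ e₁, l₂, isRegularEpi_comp _ _, ?_⟩
    rw [← cancel_mono s, Category.assoc, hf, ← Category.assoc, hl₂, Category.assoc, hl₁,
      Category.assoc, Category.assoc]

end ExactTransfer

section Rotation

variable {C : Type u₁} [Category.{v₁} C] [HasZeroMorphisms C] [Homological C]

/-- A presentation `0 ⟶ Ω ⟶ P ⟶ X ⟶ 0` of the middle object of a short exact sequence
`0 ⟶ K ⟶ X ⟶ Y ⟶ 0` gives the presentation `0 ⟶ M ⟶ P ⟶ Y ⟶ 0` and the short exact
sequence `0 ⟶ Ω ⟶ M ⟶ K ⟶ 0`. -/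
theorem exists_rotation {K X Y P Ω : C} {k : K ⟶ X} {f : X ⟶ Y} (h : IsShortExact k f)
    {i : Ω ⟶ P} {p : P ⟶ X} (hp : IsShortExact i p) :
    ∃ (M : C) (m : M ⟶ P) (α : Ω ⟶ M) (β : M ⟶ K), IsShortExact m (p ≫ f) ∧
      IsShortExact α β ∧ α ≫ m = i ∧ β ≫ k = m ≫ p := by
  have := h.isRegularEpi
  have := hp.isRegularEpi
  have := h.mono
  have := hp.mono
  have hzero : pullback.snd k p ≫ p ≫ f = 0 := by
    rw [← Category.assoc, ← pullback.condition, Category.assoc, h.zero, comp_zero]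
  obtain ⟨α, hα₁, hα₂⟩ := exists_pullback_lift k p 0 i (by rw [zero_comp, hp.zero])
  have : Mono α := mono_of_mono_fac hα₂
  have := isRegularEpi_comp p f
  refine ⟨pullback k p, pullback.snd k p, α, pullback.fst k p, ?_, ?_, hα₂, pullback.condition⟩
  · refine isShortExact_of_isRegularEpi hzero (isKernel_of_lift hzero fun W t ht => ?_)
    obtain ⟨l, hl⟩ := h.exists_lift (t ≫ p) (by rwa [Category.assoc])
    obtain ⟨l', -, hl'⟩ := exists_pullback_lift k p l t hl
    exact ⟨l', hl'⟩
  · refine isShortExact_of_isRegularEpi hα₁ (isKernel_of_lift hα₁ fun W t ht => ?_)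
    obtain ⟨l, hl⟩ := hp.exists_lift (t ≫ pullback.snd k p) (by
      rw [Category.assoc, ← pullback.condition, ← Category.assoc, ht, zero_comp])
    refine ⟨l, pullback.hom_ext ?_ ?_⟩
    · rw [Category.assoc, hα₁, comp_zero, ht]
    · rw [Category.assoc, hα₂, hl]

/-- Given right exact sequences `A ⟶ M ⟶ K ⟶ 0` and `A ⟶ P ⟶ X ⟶ 0` with a compatible
morphism `(μ, κ)`, the kernel of `μ` covers the kernel of `κ`: the comparison of `M` with the
pullback of `P` and `K` over `X` is a regular epimorphism. -/
theorem exists_local_lift_of_right_exact {A M K P X W : C} {α : A ⟶ M} {β : M ⟶ K} {γ : A ⟶ P}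
    {π : P ⟶ X} {μ : M ⟶ P} {κ : K ⟶ X} [IsRegularEpi β] (hαβ : α ≫ β = 0) (h : IsExactAt γ π)
    (hγ : α ≫ μ = γ) (hsq : μ ≫ π = β ≫ κ) (t : W ⟶ K) (ht : t ≫ κ = 0) :
    ∃ (W' : C) (e : W' ⟶ W) (l : W' ⟶ M), IsRegularEpi e ∧ l ≫ β = e ≫ t ∧ l ≫ μ = 0 := by
  obtain ⟨w, hreg⟩ := h
  obtain ⟨b, hb₁, hb₂⟩ := exists_pullback_lift π κ μ β hsq
  obtain ⟨k, hk₁, hk₂⟩ := exists_pullback_lift π κ (kernel.ι π) (0 : _ ⟶ K) (by simp)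
  have : Mono k := mono_of_mono_fac hk₁
  have hker : Nonempty (IsLimit (KernelFork.ofι k hk₂)) :=
    isKernel_of_lift hk₂ fun W t ht => by
      refine ⟨kernel.lift π (t ≫ pullback.fst π κ) ?_, pullback.hom_ext ?_ ?_⟩
      · rw [Category.assoc, pullback.condition, ← Category.assoc, ht, zero_comp]
      · rw [Category.assoc, hk₁, kernel.lift_ι]
      · rw [Category.assoc, hk₂, comp_zero, ht]
  have : IsRegularEpi (b ≫ pullback.snd π κ) := by rwa [hb₂]
  have : IsRegularEpi b := isRegularEpi_of_comp_of_kernel hker b (kernel.lift π γ w) α (by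
    apply pullback.hom_ext
    · rw [Category.assoc, Category.assoc, hk₁, hb₁, kernel.lift_ι, hγ]
    · rw [Category.assoc, Category.assoc, hk₂, hb₂, comp_zero, hαβ])
  obtain ⟨t', ht'₁, ht'₂⟩ := exists_pullback_lift π κ 0 t (by rw [ht, zero_comp])
  obtain ⟨W', e, l, he, hl⟩ := exists_local_lift b t'
  refine ⟨W', e, l, he, ?_, ?_⟩
  · rw [← hb₂, ← Category.assoc, hl, Category.assoc, ht'₂]
  · rw [← hb₁, ← Category.assoc, hl, Category.assoc, ht'₁, comp_zero]

/-- Exactness of the long exact sequence in the lowest degrees: `s` and `j` are kernels of the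
morphisms `μ` and `γ` to the chain object `P`. -/
theorem exact_low_degree {A M K P X N N' : C} {α : A ⟶ M} {β : M ⟶ K} {γ : A ⟶ P}
    {π : P ⟶ X} {μ : M ⟶ P} {κ : K ⟶ X} (hβ : IsRegularEpi β) (hαβ : IsExactAt α β)
    (hγπ : IsExactAt γ π) (hγ : α ≫ μ = γ) (hsq : μ ≫ π = β ≫ κ) {j : N ⟶ A} {s : N' ⟶ M}
    (hs : Mono s) (hsμ : s ≫ μ = 0)
    (hj : ∀ {W : C} (t : W ⟶ A), t ≫ γ = 0 → ∃ l, l ≫ j = t)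
    (hsl : ∀ {W : C} (t : W ⟶ M), t ≫ μ = 0 → ∃ l, l ≫ s = t) {g : N ⟶ N'}
    (hg : g ≫ s = j ≫ α) {c : N' ⟶ K} (hc : c = s ≫ β) : IsExactAt g c ∧ IsExactAt c κ := by
  have hαβ₀ := hαβ.choose
  constructor
  · rw [isExactAt_iff] at hαβ ⊢
    refine ⟨by rw [hc, ← Category.assoc, hg, Category.assoc, hαβ₀, comp_zero], fun W t ht => ?_⟩
    obtain ⟨W', e, l, he, hl⟩ := hαβ.2 (t ≫ s) (by rw [Category.assoc, ← hc, ht])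
    obtain ⟨l', hl'⟩ := hj l (by
      rw [← hγ, ← Category.assoc, hl, Category.assoc, Category.assoc, hsμ, comp_zero, comp_zero])
    refine ⟨W', e, l', he, ?_⟩
    rw [← cancel_mono s, Category.assoc, hg, ← Category.assoc, hl', hl, Category.assoc]
  · rw [isExactAt_iff]
    refine ⟨by rw [hc, Category.assoc, ← hsq, ← Category.assoc, hsμ, zero_comp], fun W t ht => ?_⟩
    obtain ⟨W', e, l, he, hl, hlm⟩ :=
      exists_local_lift_of_right_exact hαβ₀ hγπ hγ hsq t ht
    obtain ⟨l', hl'⟩ := hsl l hlm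
    exact ⟨W', e, l', he, by rw [hc, ← Category.assoc, hl', hl]⟩

end Rotation

namespace Tower

section Connecting

variable {C : Type u₁} [Category.{v₁} C] [HasZeroMorphisms C]
variable {E : Type u₂} [Category.{v₂} E] [HasZeroMorphisms E] [HasKernels E]
variable (F : C ⥤ E)

/-- The dimension shift from a splice to the tower it extends. -/
noncomputable def spliceShift (U : Tower C) {X Y : C} (k : U.Z 0 ⟶ X) (f : X ⟶ Y)
    (h : IsShortExact k f) (n : ℕ) : (U.splice k f h).derived F (n + 1) ⟶ U.derived F n :=
  (U.splice k f h).shift F n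

instance mono_spliceShift (U : Tower C) {X Y : C} (k : U.Z 0 ⟶ X) (f : X ⟶ Y)
    (h : IsShortExact k f) (n : ℕ) : Mono (U.spliceShift F k f h n) :=
  mono_shift F (U.splice k f h) n

instance isIso_spliceShift_succ (U : Tower C) {X Y : C} (k : U.Z 0 ⟶ X) (f : X ⟶ Y)
    (h : IsShortExact k f) (n : ℕ) : IsIso (U.spliceShift F k f h (n + 1)) :=
  isIso_shift_succ F (U.splice k f h) n

/-- The connecting morphism attached to a morphism `δ` from a tower over `Y` to the splice of
`0 ⟶ K ⟶ X ⟶ Y ⟶ 0` with a tower over `K`. -/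
noncomputable def connecting {T U : Tower C} {X Y : C} {k : U.Z 0 ⟶ X} {f : X ⟶ Y}
    {h : IsShortExact k f} (δ : Hom T (U.splice k f h)) (n : ℕ) :
    T.derived F (n + 1) ⟶ U.derived F n :=
  δ.derivedMap F (n + 1) ≫ U.spliceShift F k f h n

/-- A morphism of short exact sequences and a morphism of towers over the kernel objects induce
a morphism of splices. -/
def Hom.splice {U U' : Tower C} (ψ : Hom U U') {X Y X' Y' : C} {k : U.Z 0 ⟶ X} {f : X ⟶ Y}
    {h : IsShortExact k f} {k' : U'.Z 0 ⟶ X'} {f' : X' ⟶ Y'} {h' : IsShortExact k' f'}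
    (b : X ⟶ X') (c : Y ⟶ Y') (hk : k ≫ b = ψ.z 0 ≫ k') (hf : f ≫ c = b ≫ f') :
    Hom (U.splice k f h) (U'.splice k' f' h') :=
  Hom.cons (T := U.splice k f h) (T' := U'.splice k' f' h') ψ c b hk hf

theorem Hom.splice_spliceShift {U U' : Tower C} (ψ : Hom U U') {X Y X' Y' : C} {k : U.Z 0 ⟶ X}
    {f : X ⟶ Y} {h : IsShortExact k f} {k' : U'.Z 0 ⟶ X'} {f' : X' ⟶ Y'}
    {h' : IsShortExact k' f'} (b : X ⟶ X') (c : Y ⟶ Y') (hk : k ≫ b = ψ.z 0 ≫ k')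
    (hf : f ≫ c = b ≫ f') (n : ℕ) :
    (ψ.splice b c hk hf : Hom (U.splice k f h) (U'.splice k' f' h')).derivedMap F (n + 1) ≫
        U'.spliceShift F k' f' h' n =
      U.spliceShift F k f h n ≫ ψ.derivedMap F n :=
  Hom.shift_naturality F _ n

end Connecting

section LongExact

variable {C : Type u₁} [Category.{v₁} C] [HasZeroMorphisms C] [Homological C]
  [HasBinaryCoproducts C]
variable {E : Type u₂} [Category.{v₂} E] [HasZeroMorphisms E] [Homological E]
  [HasBinaryCoproducts E]
variable {F : C ⥤ E} [SequentiallyRightExact F]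

/-- A morphism between projective towers that is an isomorphism on augmentation objects is an
isomorphism on derived objects. -/
theorem IsProjective.isIso_derivedMap (hP : ConditionP C) (hmono : PreservesProtosplitMonos F)
    {T T' : Tower C} (hT : T.IsProjective) (hT' : T'.IsProjective) (φ : Hom T T')
    (h : IsIso (φ.z 0)) (n : ℕ) : IsIso (φ.derivedMap F n) := by
  have hF := diffComparable F hmono
  obtain ⟨ψ, hψ⟩ := hT'.exists_hom T (inv (φ.z 0))
  refine ⟨ψ.derivedMap F n, ?_, ?_⟩
  · rw [← Hom.derivedMap_comp, ← Hom.derivedMap_id]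
    refine hT.derivedMap_eq hP hF hmono _ _ ?_ n
    change φ.z 0 ≫ ψ.z 0 = 𝟙 _
    rw [hψ, IsIso.hom_inv_id]
  · rw [← Hom.derivedMap_comp, ← Hom.derivedMap_id]
    refine hT'.derivedMap_eq hP hF hmono _ _ ?_ n
    change ψ.z 0 ≫ φ.z 0 = 𝟙 _
    rw [hψ, IsIso.inv_hom_id]

/-- Rotation of the long exact sequence. For projective towers over the objects of
`0 ⟶ K ⟶ X ⟶ Y ⟶ 0` with `P` the first chain object over `X`, let `0 ⟶ Ω ⟶ M ⟶ K ⟶ 0` be the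
rotated sequence of `exists_rotation`, and choose a projective tower over `M`. Splicing
`0 ⟶ M ⟶ P ⟶ Y ⟶ 0` to it gives a second projective tower over `Y`, hence monomorphisms `s` from
the derived objects over `Y` into those over `M`, one degree lower; up to these and the dimension
shift over `X`, the morphisms of the long exact sequence of `K`, `X`, `Y` are those of the long
exact sequence of `Ω`, `M`, `K`. -/
theorem exists_rotated_towers (hproj : HasEnoughRegularProjectives C) (hP : ConditionP C)
    (hmono : PreservesProtosplitMonos F) {TK TX TY : Tower C} (hK : TK.IsProjective)
    (hX : TX.IsProjective) (hY : TY.IsProjective) {k : TK.Z 0 ⟶ TX.Z 0} {f : TX.Z 0 ⟶ TY.Z 0}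
    (hkf : IsShortExact k f) (κ : Hom TK TX) (γ : Hom TX TY) (δ : Hom TY (TK.splice k f hkf))
    (hκ : κ.z 0 = k) (hγ : γ.z 0 = f) (hδ : δ.z 0 = 𝟙 (TY.Z 0)) :
    ∃ (TM : Tower C) (m : TM.Z 0 ⟶ TX.P 0) (α : TX.tail.Z 0 ⟶ TM.Z 0) (β : TM.Z 0 ⟶ TK.Z 0)
      (hαβ : IsShortExact α β) (a : Hom TX.tail TM) (b : Hom TM TK)
      (d : Hom TK (TX.tail.splice α β hαβ)) (s : ∀ n, TY.derived F (n + 1) ⟶ TM.derived F n),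
      TM.IsProjective ∧ a.z 0 = α ∧ b.z 0 = β ∧ d.z 0 = 𝟙 (TK.Z 0) ∧
      (α ≫ m = TX.i 0 ∧ β ≫ k = m ≫ TX.p 0) ∧
      ((∀ n, Mono (s n)) ∧ ∀ n, IsIso (s (n + 1))) ∧
      (s 0 ≫ F.map m = 0 ∧ ∀ {W : E} (t : W ⟶ F.obj (TM.Z 0)), t ≫ F.map m = 0 →
        ∃ l, l ≫ s 0 = t) ∧
      (∀ n, γ.derivedMap F (n + 1) ≫ s n = TX.shift F n ≫ a.derivedMap F n) ∧
      (∀ n, connecting F δ n = s n ≫ b.derivedMap F n) ∧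
      ∀ n, κ.derivedMap F (n + 1) ≫ TX.shift F n = connecting F d n := by
  have hF := diffComparable F hmono
  obtain ⟨M, m, α, β, hm, hαβ, hαm, hβk⟩ := exists_rotation hkf (TX.exact 0)
  obtain ⟨TM, hM, rfl⟩ := exists_projective_tower hproj M
  obtain ⟨a, ha⟩ := hX.tail.exists_hom TM α
  obtain ⟨b, hb⟩ := hM.exists_hom TK β
  obtain ⟨d, hd⟩ := hK.exists_hom (TX.tail.splice α β hαβ) (𝟙 (TK.Z 0))
  have hU := hM.splice m _ hm (hX 0)
  obtain ⟨θ, hθ⟩ := hY.exists_hom (TM.splice m (TX.p 0 ≫ f) hm) (𝟙 (TY.Z 0))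
  have hθiso : ∀ n, IsIso (θ.derivedMap F n) :=
    hY.isIso_derivedMap hP hmono hU θ (by rw [hθ]; exact inferInstanceAs (IsIso (𝟙 (TY.Z 0))))
  refine ⟨TM, m, α, β, hαβ, a, b, d, fun n => θ.derivedMap F (n + 1) ≫ TM.spliceShift F m _ hm n,
    hM, ha, hb, hd, ⟨hαm, hβk⟩, ⟨fun n => mono_comp _ _, fun n => inferInstance⟩,
    ⟨?_, fun {W} t ht => ?_⟩, fun n => ?_, fun n => ?_, fun n => ?_⟩
  · exact (Category.assoc _ _ _).trans
      ((congrArg _ ((TM.splice m _ hm).derivedι_map F 0)).trans comp_zero)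
  · obtain ⟨l, hl⟩ := (TM.splice m _ hm).exists_derived_lift F 0 t ht
    refine ⟨l ≫ inv (θ.derivedMap F 1), ?_⟩
    change (l ≫ inv (θ.derivedMap F 1)) ≫ θ.derivedMap F 1 ≫ TM.spliceShift F m _ hm 0 = t
    rw [Category.assoc, IsIso.inv_hom_id_assoc]
    exact hl
  · let γ' : Hom TX (TM.splice m (TX.p 0 ≫ f) hm) :=
      Hom.cons (T := TX) (T' := TM.splice m _ hm) a f (𝟙 (TX.P 0))
        ((Category.comp_id _).trans (hαm.symm.trans (congrArg (· ≫ m) ha.symm)))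
        (Category.id_comp _).symm
    have := hX.derivedMap_eq hP hF hmono (γ.comp θ) γ'
      ((congrArg₂ (· ≫ ·) hγ hθ).trans (Category.comp_id f)) (n + 1)
    change γ.derivedMap F (n + 1) ≫ θ.derivedMap F (n + 1) ≫ TM.spliceShift F m _ hm n = _
    rw [← Category.assoc, ← Hom.derivedMap_comp, this]
    exact γ'.shift_naturality F n
  · let δ' : Hom (TM.splice m (TX.p 0 ≫ f) hm) (TK.splice k f hkf) :=
      b.splice (TX.p 0) (𝟙 (TY.Z 0)) (by rw [hb, hβk]) (Category.comp_id _)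
    have := hY.derivedMap_eq hP hF hmono δ (θ.comp δ')
      (hδ.trans ((Category.comp_id _).symm.trans (congrArg (· ≫ 𝟙 (TY.Z 0)) hθ.symm))) (n + 1)
    change _ = (θ.derivedMap F (n + 1) ≫ TM.spliceShift F m _ hm n) ≫ b.derivedMap F n
    rw [connecting, this, Hom.derivedMap_comp, Category.assoc, Category.assoc,
      Hom.splice_spliceShift]
  · let e : Hom (TX.tail.splice α β hαβ) TX :=
      Hom.cons (T := TX.tail.splice α β hαβ) (T' := TX) (Hom.id TX.tail) k m
        (hαm.trans (Category.id_comp _).symm) hβk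
    have := hK.derivedMap_eq hP hF hmono κ (d.comp e)
      (hκ.trans ((Category.id_comp _).symm.trans (congrArg (· ≫ k) hd.symm))) (n + 1)
    rw [this, Hom.derivedMap_comp, Category.assoc]
    refine congrArg _ ((e.shift_naturality F n).trans ?_)
    exact (congrArg _ (Hom.derivedMap_id F TX.tail n)).trans (Category.comp_id _)

/-- The long exact sequence of derived objects. In positive degrees, exactness at each place
for `0 ⟶ K ⟶ X ⟶ Y ⟶ 0` is exactness at the same objects for the rotated sequence, where they stand
two places further to the right. -/
theorem exact_derived (hproj : HasEnoughRegularProjectives C) (hP : ConditionP C)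
    (hmono : PreservesProtosplitMonos F) (n : ℕ) :
    ∀ {TK TX TY : Tower C} (_ : TK.IsProjective) (_ : TX.IsProjective) (_ : TY.IsProjective)
      {k : TK.Z 0 ⟶ TX.Z 0} {f : TX.Z 0 ⟶ TY.Z 0} (hkf : IsShortExact k f)
      (κ : Hom TK TX) (γ : Hom TX TY) (δ : Hom TY (TK.splice k f hkf))
      (_ : κ.z 0 = k) (_ : γ.z 0 = f) (_ : δ.z 0 = 𝟙 (TY.Z 0)),
      IsExactAt (κ.derivedMap F n) (γ.derivedMap F n) ∧
      IsExactAt (γ.derivedMap F (n + 1)) (connecting F δ n) ∧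
      IsExactAt (connecting F δ n) (κ.derivedMap F n) := by
  induction n with
  | zero =>
    intro TK TX TY hK hX hY k f hkf κ γ δ hκ hγ hδ
    obtain ⟨TM, m, α, β, hαβ, a, b, d, s, -, ha, hb, -, ⟨hαm, hβk⟩, ⟨hs, -⟩, ⟨hsm, hsl⟩, h₁, h₂,
        -⟩ :=
      exists_rotated_towers hproj hP hmono hK hX hY hkf κ γ δ hκ hγ hδ
    refine ⟨?_, ?_⟩
    · exact (congrArg₂ (fun x y => IsExactAt (F.map x) (F.map y)) hκ hγ).mpr
        (SequentiallyRightExact.exact (F := F) _ _ hkf).1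
    obtain ⟨hexα, hβ⟩ := SequentiallyRightExact.exact (F := F) _ _ hαβ
    subst ha hb hκ
    exact exact_low_degree hβ hexα (SequentiallyRightExact.exact (F := F) _ _ (TX.exact 0)).1
      ((F.map_comp _ _).symm.trans (congrArg F.map hαm))
      ((F.map_comp _ _).symm.trans ((congrArg F.map hβk.symm).trans (F.map_comp _ _)))
      (hs 0) hsm (TX.exists_derived_lift F 0) hsl (h₁ 0) (h₂ 0)
  | succ n ih =>
    intro TK TX TY hK hX hY k f hkf κ γ δ hκ hγ hδ
    obtain ⟨TM, m, α, β, hαβ, a, b, d, s, hM, ha, hb, hd, -, ⟨hs, hs'⟩, -, h₁, h₂, h₃⟩ :=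
      exists_rotated_towers hproj hP hmono hK hX hY hkf κ γ δ hκ hγ hδ
    have hs₀ := hs n
    have hs₁ := hs (n + 1)
    have hs₂ := hs' n
    obtain ⟨-, hB, hC⟩ := ih hX.tail hM hK hαβ a b d ha hb hd
    -- exactness at the derived objects of `M` in degree `n + 1` takes a second rotation
    have hA : IsExactAt (a.derivedMap F (n + 1)) (b.derivedMap F (n + 1)) := by
      obtain ⟨TM', m', α', β', hαβ', a', b', d', s', hM', ha', hb', hd', -, ⟨ht, -⟩, -, h₁', -,
          h₃'⟩ :=
        exists_rotated_towers hproj hP hmono hX.tail hM hK hαβ a b d ha hb hd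
      have := ht n
      exact (ih hM.tail hM' hX.tail hαβ' a' b' d' ha' hb' hd').2.2.of_mono (𝟙 _) (TM.shift F n)
        (s' n) ((h₃' n).trans (Category.id_comp _).symm) (h₁' n)
    refine ⟨?_, ?_, ?_⟩
    · exact hC.of_mono (𝟙 _) (TX.shift F n) (s n) ((h₃ n).trans (Category.id_comp _).symm) (h₁ n)
    · exact hA.of_mono (TX.shift F (n + 1)) (s (n + 1)) (𝟙 _) (h₁ (n + 1))
        ((Category.comp_id _).trans (h₂ (n + 1)))
    · exact hB.of_mono (s (n + 1)) (𝟙 _) (TX.shift F n) ((Category.comp_id _).trans (h₂ (n + 1)))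
        ((h₃ n).trans (Category.id_comp _).symm)

end LongExact

end Tower

/-! ### Projective resolutions and the homology of their images -/

section ResolutionTower

variable {C : Type u₁} [Category.{v₁} C] [HasZeroMorphisms C] [Homological C]

namespace ProjRes

/-- The target of the differential in degree `n` of the augmented complex. -/
noncomputable def augObj {X : C} (P : ProjRes X) : ℕ → C
  | 0 => X
  | n + 1 => P.complex.X n

/-- The differential in degree `n` of the augmented complex. -/
noncomputable def augD {X : C} (P : ProjRes X) : ∀ n, P.complex.X n ⟶ P.augObj n
  | 0 => P.d₀
  | n + 1 => P.complex.d (n + 1) n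

theorem isExactAt {X : C} (P : ProjRes X) (n : ℕ) :
    IsExactAt (P.complex.d (n + 1) n) (P.augD n) := by
  cases n with
  | zero => exact P.exact_zero
  | succ n => exact P.exact_succ n

/-- The tower of syzygies of a projective resolution. -/
noncomputable def tower {X : C} (P : ProjRes X) : Tower C where
  Z
    | 0 => X
    | n + 1 => kernel (P.augD n)
  P n := P.complex.X n
  i n := kernel.ι (P.augD n)
  p
    | 0 => P.d₀
    | n + 1 => kernel.lift (P.augD n) (P.complex.d (n + 1) n) (P.isExactAt n).choose
  exact
    | 0 => by
      have := P.isRegularEpi_d₀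
      exact isShortExact_of_isRegularEpi (kernel.condition P.d₀) ⟨kernelIsKernel P.d₀⟩
    | n + 1 => by
      have := (P.isExactAt n).choose_spec
      have hι := kernel.lift_ι (P.augD n) (P.complex.d (n + 1) n) (P.isExactAt n).choose
      have hw : kernel.ι (P.augD (n + 1)) ≫
          kernel.lift (P.augD n) (P.complex.d (n + 1) n) (P.isExactAt n).choose = 0 := by
        rw [← cancel_mono (kernel.ι (P.augD n)), Category.assoc, hι, zero_comp]
        exact kernel.condition (P.complex.d (n + 1) n)
      refine isShortExact_of_isRegularEpi hw (isKernel_of_lift hw fun W t ht => ?_)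
      have ht' : t ≫ P.complex.d (n + 1) n = 0 := by
        rw [← hι, ← Category.assoc, ht, zero_comp]
      exact ⟨kernel.lift (P.complex.d (n + 1) n) t ht', kernel.lift_ι _ _ _⟩

theorem tower_isProjective {X : C} (P : ProjRes X) : P.tower.IsProjective := P.projective

theorem tower_p_i {X : C} (P : ProjRes X) (n : ℕ) :
    P.tower.p (n + 1) ≫ P.tower.i n = P.complex.d (n + 1) n :=
  kernel.lift_ι _ _ _

end ProjRes

/-- A lifting of `x` induces a morphism of the towers of syzygies. -/
theorem IsLifting.exists_towerHom {X Y : C} {x : X ⟶ Y} {P : ProjRes X} {Q : ProjRes Y}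
    {φ : P.complex ⟶ Q.complex} (h : IsLifting x P Q φ) :
    ∃ Φ : Tower.Hom P.tower Q.tower, Φ.z 0 = x ∧ ∀ n, Φ.c n = φ.f n := by
  let a : ∀ n, P.augObj n ⟶ Q.augObj n
    | 0 => x
    | n + 1 => φ.f n
  have ha : ∀ n, P.augD n ≫ a n = φ.f n ≫ Q.augD n := fun n => by
    cases n with
    | zero => exact h.symm
    | succ n => exact (φ.comm (n + 1) n).symm
  refine ⟨⟨fun | 0 => x | n + 1 => kernel.map _ _ (φ.f n) (a n) (ha n), fun n => φ.f n,
    fun n => (kernel.lift_ι _ _ _).symm, fun | 0 => h.symm | n + 1 => ?_⟩, rfl, fun n => rfl⟩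
  refine (cancel_mono (kernel.ι (Q.augD n))).1 ?_
  refine (Category.assoc _ _ _).trans ((congrArg _ (kernel.lift_ι _ _ _)).trans ?_)
  refine (Category.assoc _ _ _).symm.trans ((congrArg (· ≫ φ.f n) (kernel.lift_ι _ _ _)).trans ?_)
  exact (φ.comm (n + 1) n).symm.trans
    ((congrArg _ (kernel.lift_ι _ _ _).symm).trans (Category.assoc _ _ _).symm)

theorem Tower.isExactAt {T : Tower C} (n : ℕ) : IsExactAt (T.p (n + 1) ≫ T.i n) (T.p n) := by
  rw [isExactAt_iff]
  refine ⟨by rw [Category.assoc, (T.exact n).zero, comp_zero], fun W t ht => ?_⟩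
  obtain ⟨l, rfl⟩ := (T.exact n).exists_lift t ht
  have := (T.exact (n + 1)).isRegularEpi
  obtain ⟨W', e, l', he, hl'⟩ := exists_local_lift (T.p (n + 1)) l
  exact ⟨W', e, l', he, by rw [← Category.assoc, hl', Category.assoc]⟩

/-- The projective resolution underlying a projective tower. -/
noncomputable def Tower.toProjRes (T : Tower C) (hT : T.IsProjective) : ProjRes (T.Z 0) where
  complex := ChainComplex.of T.P (fun n => T.p (n + 1) ≫ T.i n) (fun n => by
    rw [Category.assoc, ← Category.assoc (T.i (n + 1)), (T.exact (n + 1)).zero, zero_comp,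
      comp_zero])
  projective := hT
  d₀ := T.p 0
  isRegularEpi_d₀ := (T.exact 0).isRegularEpi
  exact_zero := by
    have h₀ := ChainComplex.of_d T.P (fun n => T.p (n + 1) ≫ T.i n) 0
    exact (congrArg (IsExactAt · (T.p 0)) h₀).mpr (T.isExactAt 0)
  exact_succ n := by
    have h₀ := ChainComplex.of_d T.P (fun n => T.p (n + 1) ≫ T.i n) n
    have h₁ := ChainComplex.of_d T.P (fun n => T.p (n + 1) ≫ T.i n) (n + 1)
    refine (congrArg₂ IsExactAt h₁ h₀).mpr ((isExactAt_iff _ _).2 ?_)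
    obtain ⟨w, h⟩ := (isExactAt_iff _ _).1 (T.isExactAt (n + 1))
    have := (T.exact n).mono
    refine ⟨by rw [← Category.assoc, w, zero_comp], fun W t ht => h t ?_⟩
    rw [← cancel_mono (T.i n), Category.assoc, ht, zero_comp]

end ResolutionTower

section Cokernel

variable {E : Type u₂} [Category.{v₂} E] [HasZeroMorphisms E] [Homological E]

theorem isCokernel_of_isExactAt {A B D : E} {f : A ⟶ B} {g : B ⟶ D} [IsRegularEpi g]
    (h : IsExactAt f g) : Nonempty (IsColimit (CokernelCofork.ofπ g h.choose)) := by
  obtain ⟨w, hreg⟩ := h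
  have hS := isShortExact_of_isRegularEpi (kernel.condition g) ⟨kernelIsKernel g⟩
  obtain ⟨hc⟩ := hS.isCokernel
  have key : ∀ {Z : E} (t : B ⟶ Z), f ≫ t = 0 → kernel.ι g ≫ t = 0 := fun t ht => by
    rw [← cancel_epi (kernel.lift g f w), ← Category.assoc, kernel.lift_ι, ht, comp_zero]
  have hdesc : ∀ {Z : E} (t : B ⟶ Z), f ≫ t = 0 → ∃ l, g ≫ l = t := fun t ht =>
    ⟨hc.desc (CokernelCofork.ofπ t (key t ht)), hc.fac _ WalkingParallelPair.one⟩
  exact ⟨CokernelCofork.IsColimit.ofπ g _ (fun t ht => (hdesc t ht).choose)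
    (fun t ht => (hdesc t ht).choose_spec)
    (fun t ht m hm => by rw [← cancel_epi g, hm, (hdesc t ht).choose_spec])⟩

/-- Left homology of a short complex `S` whose cycles are the preimage of a subobject `H` of `Z`
under a regular epimorphism `p : S.X₂ ⟶ Z`, and whose boundaries are the kernel of `p`: it
is `H`. -/
theorem exists_leftHomologyData_of_exact (S : ShortComplex E) {H Z Z' : E} (p : S.X₂ ⟶ Z)
    (τ : H ⟶ Z) [Mono τ] (i : Z' ⟶ S.X₂) (q : S.X₁ ⟶ Z') (hp : IsRegularEpi p)
    (hq : IsRegularEpi q) (hf : S.f = q ≫ i) (hex : IsExactAt i p)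
    (hg : ∀ {W : E} (t : W ⟶ S.X₂), t ≫ S.g = 0 ↔ ∃ l, l ≫ τ = t ≫ p) :
    ∃ (h : S.LeftHomologyData) (e : h.H ≅ H), h.π ≫ e.hom ≫ τ = h.i ≫ p := by
  obtain ⟨w, hex⟩ := (isExactAt_iff _ _).1 hex
  obtain ⟨π, hπ⟩ := (hg (kernel.ι S.g)).1 (kernel.condition _)
  have hreg : IsRegularEpi π := by
    obtain ⟨W, e, l, he, hl⟩ := exists_local_lift p τ
    refine isRegularEpi_of_local_lift π ⟨W, e, kernel.lift S.g l ((hg l).2 ⟨e, hl.symm⟩), he, ?_⟩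
    rw [← cancel_mono τ, Category.assoc, hπ, ← Category.assoc, kernel.lift_ι, hl]
  have hexact : IsExactAt (kernel.lift S.g S.f S.zero) π := by
    refine (isExactAt_iff _ _).2 ⟨?_, fun W t ht => ?_⟩
    · rw [← cancel_mono τ, Category.assoc, hπ, ← Category.assoc, kernel.lift_ι, hf, Category.assoc,
        w, comp_zero, zero_comp]
    · obtain ⟨W₁, e₁, l₁, he₁, hl₁⟩ := hex (t ≫ kernel.ι S.g) (by
        rw [Category.assoc, ← hπ, ← Category.assoc, ht, zero_comp])
      obtain ⟨W₂, e₂, l₂, he₂, hl₂⟩ := exists_local_lift q l₁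
      refine ⟨W₂, e₂ ≫ e₁, l₂, isRegularEpi_comp _ _, ?_⟩
      rw [← cancel_mono (kernel.ι S.g), Category.assoc, kernel.lift_ι, hf, ← Category.assoc, hl₂,
        Category.assoc, hl₁, Category.assoc, Category.assoc]
  obtain ⟨hc⟩ := isCokernel_of_isExactAt hexact
  exact ⟨⟨_, _, kernel.ι S.g, π, kernel.condition _, kernelIsKernel _, hexact.choose, hc⟩,
    Iso.refl _, by simpa using hπ⟩

end Cokernel

section LeftHomology

variable {E : Type u₂} [Category.{v₂} E] [HasZeroMorphisms E]

theorem leftHomologyπ_leftHomologyIso_comp (S : ShortComplex E) [S.HasLeftHomology]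
    (h : S.LeftHomologyData) {H Z : E} (e : h.H ≅ H) (τ : H ⟶ Z) (p : S.X₂ ⟶ Z)
    (he : h.π ≫ e.hom ≫ τ = h.i ≫ p) :
    S.leftHomologyπ ≫ (h.leftHomologyIso ≪≫ e).hom ≫ τ = S.iCycles ≫ p := by
  rw [Iso.trans_hom, Category.assoc, h.leftHomologyπ_comp_leftHomologyIso_hom_assoc, he,
    h.cyclesIso_hom_comp_i_assoc]

theorem leftHomologyMap_comp_of_mono {S S' : ShortComplex E} [S.HasLeftHomology]
    [S'.HasLeftHomology] (ψ : S ⟶ S') {H Z H' Z' : E} {e : S.leftHomology ⟶ H}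
    {e' : S'.leftHomology ⟶ H'} {τ : H ⟶ Z} {τ' : H' ⟶ Z'} [Mono τ'] {p : S.X₂ ⟶ Z}
    {p' : S'.X₂ ⟶ Z'} (he : S.leftHomologyπ ≫ e ≫ τ = S.iCycles ≫ p)
    (he' : S'.leftHomologyπ ≫ e' ≫ τ' = S'.iCycles ≫ p') (d : H ⟶ H') (z : Z ⟶ Z')
    (hd : d ≫ τ' = τ ≫ z) (hp : p ≫ z = ψ.τ₂ ≫ p') :
    ShortComplex.leftHomologyMap ψ ≫ e' = e ≫ d := by
  rw [← cancel_mono τ', ← cancel_epi S.leftHomologyπ, Category.assoc, Category.assoc, hd,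
    ShortComplex.leftHomologyπ_naturality_assoc, he', ShortComplex.cyclesMap_i_assoc, ← hp,
    ← Category.assoc, ← he, Category.assoc, Category.assoc]

end LeftHomology

section DerivedToMap

variable {C : Type u₁} [Category.{v₁} C] [HasZeroMorphisms C]
variable {E : Type u₂} [Category.{v₂} E] [HasZeroMorphisms E] [HasKernels E]
variable (F : C ⥤ E)

/-- The inclusion of a derived object into the value of `F` at the corresponding syzygy, in all
degrees. -/
noncomputable def Tower.derivedToMap (T : Tower C) : ∀ n, T.derived F n ⟶ F.obj (T.Z n)
  | 0 => 𝟙 (F.obj (T.Z 0))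
  | n + 1 => T.derivedι F n

instance (T : Tower C) (n : ℕ) : Mono (T.derivedToMap F n) := by
  cases n with
  | zero => exact inferInstanceAs (Mono (𝟙 (F.obj (T.Z 0))))
  | succ n => exact Tower.mono_derivedι F T n

theorem Tower.Hom.derivedMap_derivedToMap {T T' : Tower C} (φ : Hom T T') (n : ℕ) :
    φ.derivedMap F n ≫ T'.derivedToMap F n = T.derivedToMap F n ≫ F.map (φ.z n) := by
  cases n with
  | zero => exact (Category.comp_id _).trans (Category.id_comp _).symm
  | succ n => exact φ.derivedMap_succ_ι F n

end DerivedToMap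

section Homology

variable {C : Type u₁} [Category.{v₁} C] [HasZeroMorphisms C] [Homological C]
variable {E : Type u₂} [Category.{v₂} E] [HasZeroMorphisms E] [Homological E]
variable (F : C ⥤ E) [SequentiallyRightExact F]

theorem isProper_imageComplex {X : C} (P : ProjRes X) (n : ℕ) :
    IsProper ((imageComplex F P).d (n + 1) n) := by
  obtain ⟨w, hw⟩ := (SequentiallyRightExact.exact (F := F) _ _ (P.tower.exact n)).1
  have hp := (SequentiallyRightExact.exact (F := F) _ _ (P.tower.exact (n + 1))).2
  have key : (F.map (P.tower.p (n + 1)) ≫ kernel.lift _ _ w) ≫ kernel.ι _ =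
      F.map (P.tower.p (n + 1) ≫ P.tower.i n) := by
    rw [Category.assoc, kernel.lift_ι, F.map_comp]
  exact ⟨_, F.map (P.tower.p (n + 1)) ≫ kernel.lift _ _ w, kernel.ι (F.map (P.tower.p n)),
    isRegularEpi_comp (F.map (P.tower.p (n + 1))) (kernel.lift _ _ w),
    ⟨⟨_, _, kernel.condition _, kernelIsKernel _⟩⟩, key.trans (congrArg F.map (P.tower_p_i n))⟩

theorem comp_sc_g_eq_zero_iff {X : C} (P : ProjRes X) (n : ℕ) {W : E}
    (t : W ⟶ F.obj (P.tower.P n)) :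
    t ≫ ((imageComplex F P).sc n).g = 0 ↔
      ∃ l, l ≫ P.tower.derivedToMap F n = t ≫ F.map (P.tower.p n) := by
  cases n with
  | zero =>
    have : ((imageComplex F P).sc 0).g = 0 := (imageComplex F P).shape _ _ (by simp)
    exact ⟨fun _ => ⟨t ≫ F.map (P.tower.p 0), Category.comp_id _⟩,
      fun _ => (congrArg _ this).trans comp_zero⟩
  | succ n =>
    have key : ∀ j, j = n → (t ≫ (imageComplex F P).d (n + 1) j = 0 ↔
        (t ≫ F.map (P.tower.p (n + 1))) ≫ F.map (P.tower.i n) = 0) := by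
      rintro j rfl
      rw [Category.assoc, ← F.map_comp, P.tower_p_i]
      rfl
    refine (key _ (ChainComplex.next_nat_succ n)).trans ⟨fun h => ?_, fun ⟨l, hl⟩ => ?_⟩
    · exact P.tower.exists_derived_lift F n _ h
    · rw [← hl, Category.assoc]
      exact (congrArg _ (P.tower.derivedι_map F n)).trans comp_zero

/-- The differential into degree `n` of `F(P)` factors through the syzygy. -/
theorem imageComplex_sc_f {X : C} (P : ProjRes X) (n : ℕ) :
    ∃ e : ((imageComplex F P).sc n).X₁ ⟶ F.obj (P.tower.Z (n + 1)),
      IsRegularEpi e ∧ ((imageComplex F P).sc n).f = e ≫ F.map (P.tower.i n) := by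
  have key : ∀ j, j = n + 1 → ∃ e : (imageComplex F P).X j ⟶ F.obj (P.tower.Z (n + 1)),
      IsRegularEpi e ∧ (imageComplex F P).d j n = e ≫ F.map (P.tower.i n) := by
    rintro j rfl
    refine ⟨F.map (P.tower.p (n + 1)),
      (SequentiallyRightExact.exact (F := F) _ _ (P.tower.exact (n + 1))).2, ?_⟩
    exact (congrArg F.map (P.tower_p_i n).symm).trans (F.map_comp _ _)
  exact key _ (ChainComplex.prev ℕ n)

/-- The `n`th homology object of `F(P)` is the `n`th derived object of `F` on the tower of
syzygies of `P`. -/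
theorem exists_leftHomologyData {X : C} (P : ProjRes X) (n : ℕ) :
    ∃ (h : ((imageComplex F P).sc n).LeftHomologyData) (e : h.H ≅ P.tower.derived F n),
      h.π ≫ e.hom ≫ P.tower.derivedToMap F n = h.i ≫ F.map (P.tower.p n) := by
  obtain ⟨hex, hp⟩ := SequentiallyRightExact.exact (F := F) _ _ (P.tower.exact n)
  obtain ⟨q, hq, hf⟩ := imageComplex_sc_f F P n
  exact exists_leftHomologyData_of_exact ((imageComplex F P).sc n) (F.map (P.tower.p n))
    (P.tower.derivedToMap F n) (F.map (P.tower.i n)) q hp hq hf hex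
    (fun t => comp_sc_g_eq_zero_iff F P n t)

theorem hasResolutionHomology : HasResolutionHomology F where
  isProper P n := isProper_imageComplex F P n
  hasLeftHomology P n := by
    obtain ⟨h, -⟩ := exists_leftHomologyData F P n
    exact .mk' h

variable [HasResolutionHomology F]

theorem exists_resolutionHomologyIso {X : C} (P : ProjRes X) (n : ℕ) :
    ∃ e : resolutionHomology F P n ≅ P.tower.derived F n,
      ((imageComplex F P).sc n).leftHomologyπ ≫ e.hom ≫ P.tower.derivedToMap F n =
        ((imageComplex F P).sc n).iCycles ≫ F.map (P.tower.p n) := by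
  obtain ⟨h, e, he⟩ := exists_leftHomologyData F P n
  exact ⟨h.leftHomologyIso ≪≫ e, leftHomologyπ_leftHomologyIso_comp _ h e _ _ he⟩

/-- The homology of `F(P)` is the derived object of `F` on the tower of syzygies of `P`. -/
noncomputable def resolutionHomologyIso {X : C} (P : ProjRes X) (n : ℕ) :
    resolutionHomology F P n ≅ P.tower.derived F n :=
  (exists_resolutionHomologyIso F P n).choose

theorem resolutionHomologyIso_naturality {X Y : C} {P : ProjRes X} {Q : ProjRes Y}
    (φ : P.complex ⟶ Q.complex) (Φ : Tower.Hom P.tower Q.tower) (h : ∀ n, Φ.c n = φ.f n) (n : ℕ) :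
    resolutionHomologyMap F φ n ≫ (resolutionHomologyIso F Q n).hom =
      (resolutionHomologyIso F P n).hom ≫ Φ.derivedMap F n := by
  refine leftHomologyMap_comp_of_mono _ (exists_resolutionHomologyIso F P n).choose_spec
    (exists_resolutionHomologyIso F Q n).choose_spec (Φ.derivedMap F n) (F.map (Φ.z n))
    (Φ.derivedMap_derivedToMap F n) ?_
  refine (F.map_comp _ _).symm.trans ((congrArg F.map ?_).trans (F.map_comp _ _))
  exact (Φ.p_z n).trans (congrArg (· ≫ Q.tower.p n) (h n))

end Homology

/-! ### Derived functors -/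

section Main

variable {C : Type u₁} [Category.{v₁} C] [HasZeroMorphisms C] [Homological C]
  [HasBinaryCoproducts C]
variable {E : Type u₂} [Category.{v₂} E] [HasZeroMorphisms E] [Homological E]
  [HasBinaryCoproducts E]
variable (F : C ⥤ E) [SequentiallyRightExact F]

theorem liftingInvariant (hP : ConditionP C) (hmono : PreservesProtosplitMonos F)
    [HasResolutionHomology F] : LiftingInvariant F where
  eq x P Q φ ψ hφ hψ n := by
    obtain ⟨Φ, hΦ, hΦc⟩ := hφ.exists_towerHom
    obtain ⟨Ψ, hΨ, hΨc⟩ := hψ.exists_towerHom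
    rw [← cancel_mono (resolutionHomologyIso F Q n).hom,
      resolutionHomologyIso_naturality F φ Φ hΦc, resolutionHomologyIso_naturality F ψ Ψ hΨc,
      P.tower_isProjective.derivedMap_eq hP (diffComparable F hmono) hmono Φ Ψ (hΦ.trans hΨ.symm)]

variable {F}

theorem leftDerived_map_iso (hP : ConditionP C) (hmono : PreservesProtosplitMonos F)
    [HasResolutionHomology F] [LiftingInvariant F] (R : ∀ X : C, ProjRes X) (n : ℕ) {X Y : C}
    (x : X ⟶ Y) (Φ : Tower.Hom (R X).tower (R Y).tower) (hΦ : Φ.z 0 = x) :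
    (leftDerived F R n).map x ≫ (resolutionHomologyIso F (R Y) n).hom =
      (resolutionHomologyIso F (R X) n).hom ≫ Φ.derivedMap F n := by
  obtain ⟨Ψ, hΨ, hΨc⟩ := (exists_isLifting x (R X) (R Y)).choose_spec.exists_towerHom
  refine (resolutionHomologyIso_naturality F _ Ψ hΨc n).trans ?_
  rw [(R X).tower_isProjective.derivedMap_eq hP (diffComparable F hmono) hmono Ψ Φ
    (hΨ.trans hΦ.symm)]

theorem leftDerived_zero_iso (hP : ConditionP C) (hmono : PreservesProtosplitMonos F)
    [HasResolutionHomology F] [LiftingInvariant F] (R : ∀ X : C, ProjRes X) :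
    Nonempty (leftDerived F R 0 ≅ F) :=
  ⟨NatIso.ofComponents (fun X => resolutionHomologyIso F (R X) 0) fun {X Y} x => by
    obtain ⟨Φ, hΦ⟩ := (R X).tower_isProjective.exists_hom (R Y).tower x
    refine (leftDerived_map_iso hP hmono R 0 x Φ hΦ).trans ?_
    exact congrArg (fun y => (resolutionHomologyIso F (R X) 0).hom ≫ F.map y) hΦ⟩

/-- The terms of the long exact sequence, as derived objects of `F` on towers of syzygies. -/
noncomputable def sequenceTermIso [HasResolutionHomology F] [LiftingInvariant F]
    (R : ∀ X : C, ProjRes X) (X : C) :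
    ∀ n, (sequenceTerm F R n).obj X ≅ (R X).tower.derived F n
  | 0 => Iso.refl (F.obj X)
  | n + 1 => resolutionHomologyIso F (R X) (n + 1)

theorem sequenceTermIso_naturality (hP : ConditionP C) (hmono : PreservesProtosplitMonos F)
    [HasResolutionHomology F] [LiftingInvariant F] (R : ∀ X : C, ProjRes X) (n : ℕ) {X Y : C}
    (x : X ⟶ Y) (Φ : Tower.Hom (R X).tower (R Y).tower) (hΦ : Φ.z 0 = x) :
    (sequenceTerm F R n).map x ≫ (sequenceTermIso R Y n).hom =
      (sequenceTermIso R X n).hom ≫ Φ.derivedMap F n := by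
  cases n with
  | zero => exact (Category.comp_id _).trans ((congrArg F.map hΦ.symm).trans
      (Category.id_comp _).symm)
  | succ n => exact leftDerived_map_iso hP hmono R (n + 1) x Φ hΦ

/-- Naturality of the connecting morphisms in the towers and the short exact sequence. -/
theorem Tower.connecting_naturality (hP : ConditionP C) (hmono : PreservesProtosplitMonos F)
    {T U T' U' : Tower C} (hT : T.IsProjective) {X X' : C}
    {k : U.Z 0 ⟶ X} {f : X ⟶ T.Z 0} {h : IsShortExact k f} {k' : U'.Z 0 ⟶ X'} {f' : X' ⟶ T'.Z 0}
    {h' : IsShortExact k' f'} (δ : Hom T (U.splice k f h)) (δ' : Hom T' (U'.splice k' f' h'))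
    (hδ : δ.z 0 = 𝟙 (T.Z 0)) (hδ' : δ'.z 0 = 𝟙 (T'.Z 0)) (Φ : Hom T T') (Ψ : Hom U U')
    (b : X ⟶ X') (hk : k ≫ b = Ψ.z 0 ≫ k') (hf : f ≫ Φ.z 0 = b ≫ f') (n : ℕ) :
    Φ.derivedMap F (n + 1) ≫ connecting F δ' n = connecting F δ n ≫ Ψ.derivedMap F n := by
  have := hT.derivedMap_eq hP (diffComparable F hmono) hmono (Φ.comp δ')
    (δ.comp (Ψ.splice b (Φ.z 0) hk hf))
    ((congrArg (Φ.z 0 ≫ ·) hδ').trans ((Category.comp_id _).trans ((Category.id_comp _).symm.trans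
      (congrArg (· ≫ Φ.z 0) hδ.symm)))) (n + 1)
  rw [Hom.derivedMap_comp, Hom.derivedMap_comp] at this
  rw [connecting, connecting, ← Category.assoc, this, Category.assoc, Category.assoc,
    Hom.splice_spliceShift]

/-- The long exact sequence on the towers of syzygies of chosen resolutions, with connecting
morphisms chosen for all short exact sequences at once. -/
theorem exists_connecting (hproj : HasEnoughRegularProjectives C) (hP : ConditionP C)
    (hmono : PreservesProtosplitMonos F) (R : ∀ X : C, ProjRes X) :
    ∃ D : ∀ S : ShortComplex C, IsShortExact S.f S.g → ∀ n : ℕ,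
        (R S.X₃).tower.derived F (n + 1) ⟶ (R S.X₁).tower.derived F n,
      (∀ (S : ShortComplex C) (hS : IsShortExact S.f S.g)
        (κ : Tower.Hom (R S.X₁).tower (R S.X₂).tower)
        (γ : Tower.Hom (R S.X₂).tower (R S.X₃).tower) (_ : κ.z 0 = S.f) (_ : γ.z 0 = S.g) (n : ℕ),
        IsExactAt (κ.derivedMap F n) (γ.derivedMap F n) ∧
        IsExactAt (γ.derivedMap F (n + 1)) (D S hS n) ∧
        IsExactAt (D S hS n) (κ.derivedMap F n)) ∧
      ∀ (S T : ShortComplex C) (hS : IsShortExact S.f S.g) (hT : IsShortExact T.f T.g)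
        (φ : S ⟶ T) (Φ : Tower.Hom (R S.X₃).tower (R T.X₃).tower)
        (Ψ : Tower.Hom (R S.X₁).tower (R T.X₁).tower) (_ : Φ.z 0 = φ.τ₃) (_ : Ψ.z 0 = φ.τ₁) (n : ℕ),
        Φ.derivedMap F (n + 1) ≫ D T hT n = D S hS n ≫ Ψ.derivedMap F n := by
  have hR := fun X => (R X).tower_isProjective
  have hδ : ∀ (S : ShortComplex C) (hS : IsShortExact S.f S.g),
      ∃ δ : Tower.Hom (R S.X₃).tower ((R S.X₁).tower.splice S.f S.g hS), δ.z 0 = 𝟙 S.X₃ :=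
    fun S hS => (hR S.X₃).exists_hom ((R S.X₁).tower.splice S.f S.g hS) (𝟙 S.X₃)
  choose δ hδ using hδ
  refine ⟨fun S hS n => Tower.connecting F (δ S hS) n, fun S hS κ γ hκ hγ n => ?_,
    fun S T hS hT φ Φ Ψ hΦ hΨ n => ?_⟩
  · exact Tower.exact_derived (F := F) hproj hP hmono n (hR S.X₁) (hR S.X₂)
      (hR S.X₃) hS κ γ (δ S hS) hκ hγ (hδ S hS)
  · exact Tower.connecting_naturality hP hmono (hR S.X₃) (δ S hS) (δ T hT) (hδ S hS)
      (hδ T hT) Φ Ψ φ.τ₂ (φ.comm₁₂.symm.trans (congrArg (· ≫ T.f) hΨ.symm))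
      ((congrArg (S.g ≫ ·) hΦ).trans φ.comm₂₃.symm) n

end Main

end NonAdditive

theorem theorem9p11
    {C : Type u₁} [Category.{v₁} C] [HasZeroMorphisms C] [Homological C] [HasBinaryCoproducts C]
    (hproj : HasEnoughRegularProjectives C) (hP : ConditionP C)
    {E : Type u₂} [Category.{v₂} E] [HasZeroMorphisms E] [Homological E] [HasBinaryCoproducts E]
    (F : C ⥤ E) [SequentiallyRightExact F] (hmono : PreservesProtosplitMonos F)
    [PreservesColimitsOfShape (Discrete WalkingPair) F] :
    -- projective resolutions exist, and the derived functors `L_n(F)` are well defined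
    (∀ X : C, Nonempty (ProjRes X)) ∧
    ∃ (_ : HasResolutionHomology F) (_ : LiftingInvariant F),
      ∀ R : ∀ X : C, ProjRes X,
        Nonempty (leftDerived F R 0 ≅ F) ∧
        -- the connecting morphisms, for all short exact sequences and all `n`
        ∃ δ : ∀ S : ShortComplex C, IsShortExact S.f S.g → ∀ n : ℕ,
            ((sequenceTerm F R (n + 1)).obj S.X₃ ⟶ (sequenceTerm F R n).obj S.X₁),
          -- exactness
          (∀ (S : ShortComplex C) (hS : IsShortExact S.f S.g),
            (∀ n : ℕ,
              IsExactAt ((sequenceTerm F R n).map S.f) ((sequenceTerm F R n).map S.g) ∧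
              IsExactAt ((sequenceTerm F R (n + 1)).map S.g) (δ S hS n) ∧
              IsExactAt (δ S hS n) ((sequenceTerm F R n).map S.f)) ∧
            IsRegularEpi (F.map S.g)) ∧
          -- naturality
          (∀ (S T : ShortComplex C) (hS : IsShortExact S.f S.g) (hT : IsShortExact T.f T.g)
            (φ : S ⟶ T) (n : ℕ),
            (sequenceTerm F R (n + 1)).map φ.τ₃ ≫ δ T hT n =
              δ S hS n ≫ (sequenceTerm F R n).map φ.τ₁) := by
  refine ⟨fun X => ?_, hasResolutionHomology F, ?_⟩
  · obtain ⟨T, hT, rfl⟩ := exists_projective_tower hproj X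
    exact ⟨T.toProjRes hT⟩
  have := hasResolutionHomology F
  refine ⟨liftingInvariant F hP hmono, fun R => ?_⟩
  have := liftingInvariant F hP hmono
  refine ⟨leftDerived_zero_iso hP hmono R, ?_⟩
  have hR := fun X => (R X).tower_isProjective
  obtain ⟨D, hD, hD'⟩ := exists_connecting (F := F) hproj hP hmono R
  refine ⟨fun S hS n => (sequenceTermIso R S.X₃ (n + 1)).hom ≫ D S hS n ≫
    (sequenceTermIso R S.X₁ n).inv, fun S hS => ⟨fun n => ?_, ?_⟩, fun S T hS hT φ n => ?_⟩
  · obtain ⟨κ, hκ⟩ := (hR S.X₁).exists_hom (R S.X₂).tower S.f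
    obtain ⟨γ, hγ⟩ := (hR S.X₂).exists_hom (R S.X₃).tower S.g
    obtain ⟨h₁, h₂, h₃⟩ := hD S hS κ γ hκ hγ n
    have hκ' := fun n => sequenceTermIso_naturality hP hmono R n S.f κ hκ
    have hγ' := fun n => sequenceTermIso_naturality hP hmono R n S.g γ hγ
    exact ⟨h₁.of_mono (sequenceTermIso R _ _).hom (sequenceTermIso R _ _).hom
        (sequenceTermIso R _ _).hom (hκ' n) (hγ' n),
      h₂.of_mono (sequenceTermIso R _ _).hom (sequenceTermIso R _ _).hom
        (sequenceTermIso R _ _).hom (hγ' (n + 1)) (by simp),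
      h₃.of_mono (sequenceTermIso R _ _).hom (sequenceTermIso R _ _).hom
        (sequenceTermIso R _ _).hom (by simp) (hκ' n)⟩
  · exact (SequentiallyRightExact.exact (F := F) _ _ hS).2
  · obtain ⟨Φ, hΦ⟩ := (hR S.X₃).exists_hom (R T.X₃).tower φ.τ₃
    obtain ⟨Ψ, hΨ⟩ := (hR S.X₁).exists_hom (R T.X₁).tower φ.τ₁
    have h₃ := sequenceTermIso_naturality hP hmono R (n + 1) φ.τ₃ Φ hΦ
    have h₁ := sequenceTermIso_naturality hP hmono R n φ.τ₁ Ψ hΨ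
    have h := hD' S T hS hT φ Φ Ψ hΦ hΨ n
    rw [← cancel_mono (sequenceTermIso R T.X₁ n).hom]
    simp only [Category.assoc, Iso.inv_hom_id, Category.comp_id, h₁]
    rw [← Category.assoc, h₃, Category.assoc, h, Iso.inv_hom_id_assoc]
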